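/- **Model.** Let the positions of the small base stations (SBS, tier $s$) and of the macro base stations (MBS, tier $m$) be independent homogeneous Poisson point processes in $\mathbb R^2$ with densities $\lambda_s,\lambda_m>0$, and let the typical user be at the origin. Given all positions, the links to the base stations are independently line-of-sight (state $\mathrm L$) or not (state $\mathrm{NL}$); a link of length $r$ is LoS with probability $\mathcal P_{\mathrm L}(r)=\min(18/r,1)(1-e^{-\beta r})+e^{-\beta r}$, where $\beta\ge 0$, and NLoS with probability $\mathcal P_{\mathrm{NL}}(r)=1-\mathcal P_{\mathrm L}(r)$. A base station of tier $k\in\{s,m\}$ at distance $r$ with link state $t\in\{\mathrm L,\mathrm{NL}\}$ offers the biased received power $P_kB_kA_tr^{-\alpha_t}$, with $P_k,B_k,A_t,\alpha_t>0$; the user is associated with a base station if no base station of either tier offers a larger biased received power. **Notation.** For tiers $k,k'$, link states $t,t'$ and $\rho\ge 0$, $r>0$, let $p^{kk'}_{tt'}(\rho;r)$ be the probability that no base station of tier $k'$ that is at distance at least $\rho$ and has link state $t'$ offers a biased received power larger than $P_kB_kA_tr^{-\alpha_t}$; write $p^{kk'}_{tt'}(r)=p^{kk'}_{tt'}(0;r)$.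 In these indices $l$ stands for $\mathrm L$ and $n$ for $\mathrm{NL}$. For a tier $k$ let $k'$ be the other tier, for a link state $t$ let $t'$ be the other state, and let $$f^{t}_{R_k}(r)=\mathcal P_t(r)\,e^{-\pi r^2\lambda_k}\,2\pi r\lambda_k,\qquad g^{t}_{R_k}(r)=\mathcal P_t(r)\,e^{-2\pi\lambda_k\int_0^r\mathcal P_t(u)u\,du}\,2\pi r\lambda_k .$$ **Proposition.** For each tier $k$ and each link state $t$, the following hold, where a (sub-probability) density on $(0,\infty)$ means that the probability of the event together with the distance lying in a Borel set $B$ is the integral of the density over $B\cap(0,\infty)$. 1. $f^{t}_{R_k}$ is the density of the distance to the nearest base station of tier $k$ on the event that its link is in state $t$. The density of this distance on the event that, moreover, the user is associated with this nearest base station is $$F^{t}_{k}(r)=p^{kk}_{tt'}(r;r)\;p^{kk'}_{tl}(r)\;p^{kk'}_{tn}(r)\;f^{t}_{R_k}(r).$$ 2. $g^{t}_{R_k}$ is the density of the distance to the nearest one among the base stations of tier $k$ with link state $t$ (on the event that there is one). The density of the distance to the associated base station, on the event that it is any base station of tier $k$ (not necessarily the nearest of its tier) with link state $t$, is $$G^{t}_{k}(r)=p^{kk}_{tt'}(r)\;p^{kk'}_{tl}(r)\;p^{kk'}_{tn}(r)\;g^{t}_{R_k}(r).$$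 For instance, for $k=s$ the products in part 1 are $F^{\mathrm L}_s=p^{ss}_{ln}(r;r)\,p^{sm}_{ll}(r)\,p^{sm}_{ln}(r)\,f^{\mathrm L}_{R_s}(r)$ and $F^{\mathrm{NL}}_s=p^{ss}_{nl}(r;r)\,p^{sm}_{nl}(r)\,p^{sm}_{nn}(r)\,f^{\mathrm{NL}}_{R_s}(r)$, and for $k=m$ the roles of $s$ and $m$ are exchanged. -/

import Mathlib

open MeasureTheory ProbabilityTheory
open scoped ENNReal NNReal

noncomputable section

namespace HetNet

/-- The two tiers: small base stations (SBS) and macro base stations (MBS). -/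
inductive Tier
  | sbs
  | mbs

/-- The other tier. -/
def Tier.other : Tier → Tier
  | .sbs => .mbs
  | .mbs => .sbs

/-- The state of the link from a base station to the user: line of sight or not. -/
inductive Link
  | los
  | nlos

/-- The other link state. -/
def Link.other : Link → Link
  | .los => .nlos
  | .nlos => .los

instance : MeasurableSpace Link := ⊤

/-- The plane with its Euclidean norm; the typical user sits at the origin. -/
abbrev Plane := EuclideanSpace ℝ (Fin 2)

/-- Parameters of the two-tier network. -/
structure Params where
  /-- density of the base stations of each tier -/
  lam : Tier → ℝ
  /-- transmission power of each tier -/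
  power : Tier → ℝ
  /-- association bias factor of each tier -/
  bias : Tier → ℝ
  /-- path loss constant for each link state -/
  A : Link → ℝ
  /-- path loss exponent for each link state -/
  α : Link → ℝ
  /-- blockage parameter -/
  β : ℝ
  lam_pos : ∀ k, 0 < lam k
  power_pos : ∀ k, 0 < power k
  bias_pos : ∀ k, 0 < bias k
  A_pos : ∀ t, 0 < A t
  α_pos : ∀ t, 0 < α t
  β_nonneg : 0 ≤ β

namespace Params

variable (par : Params)

/-- The LoS probability `min (18 / r) 1 * (1 - exp (- β r)) + exp (- β r)` of a link of
length `r`. -/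
def losProb (r : ℝ) : ℝ :=
  min (18 / r) 1 * (1 - Real.exp (-(par.β * r))) + Real.exp (-(par.β * r))

/-- The probability that a link of length `r` is in a given state. -/
def linkProb : Link → ℝ → ℝ
  | .los, r => par.losProb r
  | .nlos, r => 1 - par.losProb r

/-- Biased received power `P_k B_k A_t r ^ (- α_t)` from a base station of tier `k` at distance
`r` over a link in state `t`. -/
def biasedPower (k : Tier) (t : Link) (r : ℝ) : ℝ :=
  par.power k * par.bias k * (par.A t * r ^ (-(par.α t)))

/-- The density of the distance to the nearest base station of tier `k`, that base station having
a link in state `t`: `P_t(r) exp (- π r² λ_k) 2 π r λ_k`. -/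
def nearestDensity (k : Tier) (t : Link) (r : ℝ) : ℝ :=
  par.linkProb t r * Real.exp (-(Real.pi * r ^ 2 * par.lam k)) * (2 * Real.pi * r * par.lam k)

/-- The density of the distance to the nearest one among those base stations of tier `k` whose
link is in state `t`: `P_t(r) exp (- 2 π λ_k ∫₀ʳ P_t(u) u du) 2 π r λ_k`. -/
def nearestOfTypeDensity (k : Tier) (t : Link) (r : ℝ) : ℝ :=
  par.linkProb t r
    * Real.exp (-(2 * Real.pi * par.lam k * ∫ u in (0 : ℝ)..r, par.linkProb t u * u))
    * (2 * Real.pi * r * par.lam k)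

end Params

/-- The counting measure (with multiplicity) of a sequence of points of the plane. -/
def pointMeasure (x : ℕ → Plane) : Measure Plane :=
  Measure.sum fun i => Measure.dirac (x i)

variable {Ω : Type*} [MeasurableSpace Ω]

/-- `N` is a homogeneous Poisson point process in the plane with density `lam`: the number of
points in a measurable set of finite area is Poisson distributed with mean `lam` times the area,
and the numbers of points in finitely many disjoint measurable sets are independent. -/
structure IsPoissonProcess (P : Measure Ω) (N : Ω → Measure Plane) (lam : ℝ) : Prop where
  poisson : ∀ A : Set Plane, MeasurableSet A → volume A ≠ ∞ →
    P.map (fun ω => N ω A) =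
      (poissonMeasure (lam.toNNReal * (volume A).toNNReal)).map (fun n : ℕ => (n : ℝ≥0∞))
  indep : ∀ (n : ℕ) (A : Fin n → Set Plane), (∀ j, MeasurableSet (A j)) →
    Pairwise (fun i j => Disjoint (A i) (A j)) → iIndepFun (fun j ω => N ω (A j)) P

/-- The network model. `X k i` is the position of the `i`-th base station of tier `k`, and `S k i`
is the state of the link between it and the typical user at the origin. The positions of the two
tiers form independent Poisson processes; given all positions, the link states are independent,
and a link of length `r` is in state `t` with probability `linkProb t r`. -/
structure IsHetNet (par : Params) (P : Measure Ω)
    (X : Tier → ℕ → Ω → Plane) (S : Tier → ℕ → Ω → Link) : Prop where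
  measurable_pos : ∀ k i, Measurable (X k i)
  measurable_link : ∀ k i, Measurable (S k i)
  poisson : ∀ k, IsPoissonProcess P (fun ω => pointMeasure fun i => X k i ω) (par.lam k)
  indep : IndepFun (fun ω => pointMeasure fun i => X .sbs i ω)
    (fun ω => pointMeasure fun i => X .mbs i ω) P
  links : ∀ (I : Finset (Tier × ℕ)) (s : Tier × ℕ → Link) (E : Set Ω),
    MeasurableSet[⨆ (k : Tier) (i : ℕ), MeasurableSpace.comap (X k i) inferInstance] E →
    P (E ∩ {ω | ∀ q ∈ I, S q.1 q.2 ω = s q}) =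
      ∫⁻ ω in E, ∏ q ∈ I, ENNReal.ofReal (par.linkProb (s q) ‖X q.1 q.2 ω‖) ∂P

section Events

variable (par : Params) (P : Measure Ω) (X : Tier → ℕ → Ω → Plane) (S : Tier → ℕ → Ω → Link)

/-- Maximum biased received power association: in the outcome `ω` the user is associated with the
`i`-th base station of tier `k`, that is, no base station of either tier offers a larger biased
received power. -/
def Associated (ω : Ω) (k : Tier) (i : ℕ) : Prop :=
  ∀ (k' : Tier) (j : ℕ), par.biasedPower k' (S k' j ω) ‖X k' j ω‖
    ≤ par.biasedPower k (S k i ω) ‖X k i ω‖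

/-- The `i`-th base station of tier `k` is a nearest one of its tier. -/
def Nearest (ω : Ω) (k : Tier) (i : ℕ) : Prop :=
  ∀ j : ℕ, ‖X k i ω‖ ≤ ‖X k j ω‖

/-- The `i`-th base station of tier `k` is a nearest one among those base stations of its tier
whose link is in the same state. -/
def NearestOfType (ω : Ω) (k : Tier) (i : ℕ) : Prop :=
  ∀ j : ℕ, S k j ω = S k i ω → ‖X k i ω‖ ≤ ‖X k j ω‖

/-- The probability that no base station of tier `k'` at distance at least `ρ` and with link
state `t'` has a larger biased received power than a base station of tier `k` at distance `r` with
link state `t`. -/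
def noStrongerProb (k : Tier) (t : Link) (k' : Tier) (t' : Link) (ρ r : ℝ) : ℝ≥0∞ :=
  P {ω | ∀ j : ℕ, ρ ≤ ‖X k' j ω‖ → S k' j ω = t' →
    par.biasedPower k' t' ‖X k' j ω‖ ≤ par.biasedPower k t r}

/-- The random distance of the base station of tier `k` selected by the rule `sel` has, on the
event that its link is in state `t`, the density `F` on the positive half-line. -/
def HasDistanceDensity (sel : Ω → ℕ → Prop) (k : Tier) (t : Link) (F : ℝ → ℝ≥0∞) : Prop :=
  ∀ B : Set ℝ, MeasurableSet B →
    P {ω | ∃ i : ℕ, sel ω i ∧ S k i ω = t ∧ ‖X k i ω‖ ∈ B} = ∫⁻ r in B ∩ Set.Ioi 0, F r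

end Events

end HetNet

end

open MeasureTheory ProbabilityTheory Filter Topology
open scoped ENNReal NNReal

/-! Sort the base stations into four types `τ`, a type being a tier together with a link state, and
let `R_τ` be the distance from the origin to the nearest station of type `τ` (`∞` if there is none).
Everything rests on one fact: the `R_τ` are independent, and `P(R_τ ≥ r) = exp(-Λ_τ(r))`, where
`Λ_τ(r) = 2πλ ∫₀ʳ P_t(u) u du` is the mean number of stations of type `τ` within distance `r`.

This is the thinning theorem in the form of void probabilities (`measure_avoid`). Prescribe a
forbidden region for each type. Given the positions, the links avoid these regions with probability
`∏ᵢ a(xᵢ)`, where `a` is `avoidProb`. The mean of this product is the Laplace functional of the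
Poisson process at `-log a`, so it is `exp(-λ ∫ (1 - a))` for each tier. Since `1 - a` is a sum over
link states, the result factors over the four types. The function `a` may vanish, hence exponentials
and logarithms with values in `[0, ∞]`.

Power decreases strictly with distance within a type. So the associated station of type `(k, t)` is
the nearest of its type, and association only compares the four `R_τ`. Fixing `R_(k,t) = r` and
using independence gives the density `g(r)` of `R_(k,t)` times one probability for each of the other
three types (`measure_typeDist_mem`). For the nearest station of the whole tier, the other state
contributes the extra constraint `R ≥ r`. This turns `g` into `f`, because the two means within
distance `r` add up to `πr²λ`, and it turns the void probability of the stronger region into `p(r;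
r)`, because that region beyond `r` is disjoint from the ball (`noStrongerProb_mul`). -/

noncomputable section

namespace HetNet

/-! ### Exponentials on `[0, ∞]` and the Laplace transform of the Poisson law -/

/-- The function `x ↦ exp (-x)` on the extended nonnegative reals, with value `0` at `∞`. -/
def expNeg (x : ℝ≥0∞) : ℝ≥0∞ := EReal.exp (-(x : EReal))

@[simp] lemma expNeg_zero : expNeg 0 = 1 := by simp [expNeg]

@[simp] lemma expNeg_top : expNeg ∞ = 0 := by simp [expNeg]

lemma expNeg_add (x y : ℝ≥0∞) : expNeg (x + y) = expNeg x * expNeg y := by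
  rw [expNeg, EReal.coe_ennreal_add, EReal.neg_add (by simp) (by simp), sub_eq_add_neg,
    EReal.exp_add, expNeg, expNeg]

lemma expNeg_sum {ι : Type*} (s : Finset ι) (f : ι → ℝ≥0∞) :
    expNeg (∑ i ∈ s, f i) = ∏ i ∈ s, expNeg (f i) := by
  classical
  induction s using Finset.induction_on with
  | empty => simp
  | insert a s ha ih => rw [Finset.sum_insert ha, Finset.prod_insert ha, expNeg_add, ih]

lemma expNeg_nat_mul (n : ℕ) (x : ℝ≥0∞) : expNeg (n * x) = expNeg x ^ n := by
  simpa using expNeg_sum (Finset.range n) fun _ => x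

lemma continuous_expNeg : Continuous expNeg :=
  ENNReal.continuous_exp.comp (continuous_neg.comp continuous_coe_ennreal_ereal)

lemma measurable_expNeg : Measurable expNeg := continuous_expNeg.measurable

lemma antitone_expNeg : Antitone expNeg := fun _ _ h =>
  EReal.exp_monotone (EReal.neg_le_neg_iff.2 (EReal.coe_ennreal_le_coe_ennreal_iff.2 h))

lemma expNeg_le_one (x : ℝ≥0∞) : expNeg x ≤ 1 :=
  (antitone_expNeg zero_le).trans_eq expNeg_zero

lemma expNeg_ofReal {a : ℝ} (ha : 0 ≤ a) :
    expNeg (ENNReal.ofReal a) = ENNReal.ofReal (Real.exp (-a)) := by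
  rw [expNeg, EReal.coe_ennreal_ofReal, max_eq_left ha, ← EReal.coe_neg, EReal.exp_coe]

/-- The inverse of `expNeg`: minus the logarithm of a number in `[0, 1]`. -/
def negLog (u : ℝ≥0∞) : ℝ≥0∞ := (-(ENNReal.log u)).toENNReal

lemma expNeg_negLog {u : ℝ≥0∞} (hu : u ≤ 1) : expNeg (negLog u) = u := by
  have h : 0 ≤ -(ENNReal.log u) := by
    rw [EReal.le_neg, neg_zero]
    exact ENNReal.log_le_zero_iff.2 hu
  rw [expNeg, negLog, EReal.coe_toENNReal h, neg_neg, ENNReal.exp_log]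

lemma measurable_negLog : Measurable negLog :=
  (measurable_id.ennreal_log.neg).ereal_toENNReal

/-- The Laplace transform of the Poisson distribution. -/
lemma lintegral_expNeg_poissonMeasure (r : ℝ≥0) (c : ℝ≥0∞) :
    ∫⁻ n : ℕ, expNeg (c * n) ∂poissonMeasure r = expNeg (r * (1 - expNeg c)) := by
  -- In terms of `v` the claim is the exponential series `∑ e⁻ʳ (r v)ⁿ / n! = exp (-r (1 - v))`. The
  -- case `c = ∞` is included as `v = 0`.
  obtain ⟨v, hv⟩ : ∃ v : ℝ≥0, expNeg c = v :=
    ⟨_, (ENNReal.coe_toNNReal ((expNeg_le_one c).trans_lt ENNReal.one_lt_top).ne).symm⟩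
  have hv1 : (v : ℝ) ≤ 1 := by
    have := expNeg_le_one c
    rw [hv] at this
    exact_mod_cast this
  have hs : HasSum (fun n : ℕ => Real.exp (-r) * ((r * v : ℝ) ^ n / n.factorial))
      (Real.exp (-r) * Real.exp (r * v)) := by
    have := (NormedSpace.expSeries_div_hasSum_exp (r * v : ℝ)).mul_left (Real.exp (-r))
    rwa [← Real.exp_eq_exp_ℝ] at this
  have hr : (r : ℝ≥0∞) * (1 - v) = ENNReal.ofReal (r * (1 - v)) := by
    rw [ENNReal.ofReal_mul r.coe_nonneg, ENNReal.ofReal_sub _ v.coe_nonneg]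
    simp
  rw [poissonMeasure, lintegral_sum_measure]
  simp_rw [lintegral_smul_measure, lintegral_dirac, mul_comm c, expNeg_nat_mul, hv]
  rw [hr, expNeg_ofReal (mul_nonneg r.coe_nonneg (by linarith)),
    show -(r * (1 - v) : ℝ) = -r + r * v by ring, Real.exp_add, ← hs.tsum_eq,
    ENNReal.ofReal_tsum_of_nonneg (fun n => by positivity) hs.summable]
  refine tsum_congr fun n => ?_
  rw [smul_eq_mul, ← ENNReal.ofReal_coe_nnreal (p := v), ← ENNReal.ofReal_pow v.coe_nonneg,
    ← ENNReal.ofReal_mul (by positivity)]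
  congr 1
  rw [mul_pow]
  ring

/-! ### The Laplace functional of a Poisson process -/

section Laplace

variable {Ω : Type*} [MeasurableSpace Ω] {P : Measure Ω}
  {N : Ω → Measure Plane} {lam : ℝ}

lemma IsPoissonProcess.lintegral_expNeg_mul (hN : IsPoissonProcess P N lam)
    (hNm : Measurable N) {A : Set Plane} (hA : MeasurableSet A) (hvol : volume A ≠ ∞) (c : ℝ≥0∞) :
    ∫⁻ ω, expNeg (c * N ω A) ∂P
      = expNeg (lam.toNNReal * ((1 - expNeg c) * volume A)) := by
  have hf : Measurable fun x : ℝ≥0∞ => expNeg (c * x) :=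
    measurable_expNeg.comp (measurable_const.mul measurable_id)
  have hNA : Measurable fun ω => N ω A := (Measure.measurable_coe hA).comp hNm
  rw [← lintegral_map hf hNA, hN.poisson A hA hvol, lintegral_map hf (measurable_from_nat),
    lintegral_expNeg_poissonMeasure, ENNReal.coe_mul, ENNReal.coe_toNNReal hvol]
  ring_nf

lemma IsPoissonProcess.ae_lt_top (hN : IsPoissonProcess P N lam)
    (hNm : Measurable N) {A : Set Plane} (hA : MeasurableSet A) (hvol : volume A ≠ ∞) :
    ∀ᵐ ω ∂P, N ω A < ∞ := by
  have hNA : Measurable fun ω => N ω A := (Measure.measurable_coe hA).comp hNm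
  have h : ∀ᵐ x ∂(P.map fun ω => N ω A), x < ∞ := by
    rw [hN.poisson A hA hvol, ae_map_iff measurable_from_nat.aemeasurable measurableSet_Iio]
    exact Eventually.of_forall fun n => by simp
  exact ae_of_ae_map hNA.aemeasurable h

/-- The level sets are disjoint, so their counts are independent and the exponential of the finite
sum factors into Poisson Laplace transforms. -/
lemma IsPoissonProcess.lintegral_expNeg_simpleFunc [IsProbabilityMeasure P]
    (hN : IsPoissonProcess P N lam)
    (hNm : Measurable N) (g : SimpleFunc Plane ℝ≥0∞) (hg : g.FinMeasSupp volume) :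
    ∫⁻ ω, expNeg (∫⁻ x, g x ∂N ω) ∂P
      = expNeg (lam.toNNReal * ∫⁻ x, (1 - expNeg (g x))) := by
  have hindep : iIndepFun (fun (y : g.range) ω => N ω (g ⁻¹' {(y : ℝ≥0∞)})) P := by
    have h := hN.indep (Fintype.card g.range)
      (fun j => g ⁻¹' {((Fintype.equivFin g.range).symm j : ℝ≥0∞)})
      (fun j => g.measurableSet_fiber _) (fun i j hij => by
        refine Disjoint.preimage g (Set.disjoint_singleton.2 fun h => hij ?_)
        exact (Fintype.equivFin g.range).symm.injective (Subtype.ext h))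
    simpa using h.precomp (Fintype.equivFin g.range).injective
  have hm : ∀ y : g.range, Measurable fun x : ℝ≥0∞ => expNeg ((y : ℝ≥0∞) * x) := fun y =>
    measurable_expNeg.comp (measurable_const.mul measurable_id)
  have hNA : ∀ y, Measurable fun ω => N ω (g ⁻¹' {y}) := fun y =>
    (Measure.measurable_coe (g.measurableSet_fiber y)).comp hNm
  have hprod := lintegral_prod_eq_prod_lintegral_of_indepFun Finset.univ _
    (hindep.comp (fun y x => expNeg ((y : ℝ≥0∞) * x)) hm) fun y => (hm y).comp (hNA y)
  have hmap : ∫⁻ x, (1 - expNeg (g x))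
      = ∑ y ∈ g.range, (1 - expNeg y) * volume (g ⁻¹' {y}) := by
    rw [← SimpleFunc.map_lintegral (fun y => 1 - expNeg y) g, ← SimpleFunc.lintegral_eq_lintegral]
    rfl
  have hcalc : ∀ y : g.range, ∫⁻ ω, expNeg ((y : ℝ≥0∞) * N ω (g ⁻¹' {(y : ℝ≥0∞)})) ∂P
      = expNeg (lam.toNNReal * ((1 - expNeg y) * volume (g ⁻¹' {(y : ℝ≥0∞)}))) := by
    intro y
    -- The zero level set may have infinite area, but its factor is `1` on both sides.
    by_cases hy : (y : ℝ≥0∞) = 0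
    · simp [hy]
    · exact hN.lintegral_expNeg_mul hNm (g.measurableSet_fiber _)
        (hg.meas_preimage_singleton_ne_zero hy).ne _
  rw [hmap, Finset.mul_sum, expNeg_sum,
    ← Finset.prod_coe_sort g.range fun y =>
      expNeg (lam.toNNReal * ((1 - expNeg y) * volume (g ⁻¹' {y})))]
  simp_rw [← hcalc]
  refine Eq.trans (lintegral_congr fun ω => ?_) hprod
  rw [SimpleFunc.lintegral_eq_lintegral, SimpleFunc.lintegral, expNeg_sum, ← Finset.prod_coe_sort]
  rfl

/-- The Laplace functional of a Poisson process. -/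
theorem IsPoissonProcess.lintegral_expNeg [IsProbabilityMeasure P] (hN : IsPoissonProcess P N lam)
    (hNm : Measurable N) {f : Plane → ℝ≥0∞} (hf : Measurable f) :
    ∫⁻ ω, expNeg (∫⁻ x, f x ∂N ω) ∂P
      = expNeg (lam.toNNReal * ∫⁻ x, (1 - expNeg (f x))) := by
  -- Restriction to growing balls gives every nonzero level set finite area and keeps the sequence
  -- increasing to `f`.
  set g : ℕ → SimpleFunc Plane ℝ≥0∞ := fun n =>
    (SimpleFunc.eapprox f n).restrict (Metric.closedBall 0 n) with hg
  have hga : ∀ n x, g n x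
      = (Metric.closedBall (0 : Plane) n).indicator (SimpleFunc.eapprox f n) x := fun n x =>
    SimpleFunc.restrict_apply _ measurableSet_closedBall x
  have hfin : ∀ n, (g n).FinMeasSupp volume := fun n => by
    rw [SimpleFunc.finMeasSupp_iff_support]
    refine (measure_mono ?_).trans_lt (measure_closedBall_lt_top (x := (0 : Plane)) (r := n))
    intro x hx
    by_contra h
    exact hx (by rw [hga, Set.indicator_of_notMem h])
  have hmono : ∀ x, Monotone fun n => g n x := fun x m n hmn => by
    simp only [hga]
    exact Set.indicator_le_indicator_of_subset
        (Metric.closedBall_subset_closedBall (Nat.cast_le.2 hmn)) (fun _ => zero_le) x |>.trans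
      (Set.indicator_le_indicator (SimpleFunc.monotone_eapprox f hmn x))
  have htend : ∀ x, Tendsto (fun n => g n x) atTop (𝓝 (f x)) := fun x => by
    have h : Tendsto (fun n => SimpleFunc.eapprox f n x) atTop (𝓝 (f x)) := by
      rw [← SimpleFunc.iSup_eapprox_apply hf x]
      exact tendsto_atTop_iSup fun m n hmn => SimpleFunc.monotone_eapprox f hmn x
    refine h.congr' ?_
    filter_upwards [eventually_ge_atTop ⌈‖x‖⌉₊] with n hn
    rw [hga, Set.indicator_of_mem]
    simpa using Nat.ceil_le.1 hn
  have hmeas : ∀ n, Measurable (g n) := fun n => (g n).measurable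
  have hleft : Tendsto (fun n => ∫⁻ ω, expNeg (∫⁻ x, g n x ∂N ω) ∂P) atTop
      (𝓝 (∫⁻ ω, expNeg (∫⁻ x, f x ∂N ω) ∂P)) := by
    refine tendsto_lintegral_of_dominated_convergence (fun _ => 1)
      (fun n => measurable_expNeg.comp ((Measure.measurable_lintegral (hmeas n)).comp hNm))
      (fun n => Eventually.of_forall fun ω => expNeg_le_one _) (by simp)
      (Eventually.of_forall fun ω => (continuous_expNeg.tendsto _).comp ?_)
    exact lintegral_tendsto_of_tendsto_of_monotone (fun n => (hmeas n).aemeasurable)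
      (Eventually.of_forall hmono) (Eventually.of_forall htend)
  have hright : Tendsto (fun n => expNeg (lam.toNNReal * ∫⁻ x, (1 - expNeg (g n x)))) atTop
      (𝓝 (expNeg (lam.toNNReal * ∫⁻ x, (1 - expNeg (f x))))) := by
    refine (continuous_expNeg.tendsto _).comp
      (ENNReal.Tendsto.const_mul ?_ (Or.inr ENNReal.coe_ne_top))
    refine lintegral_tendsto_of_tendsto_of_monotone
      (fun n => (measurable_const.sub (measurable_expNeg.comp (hmeas n))).aemeasurable)
      (Eventually.of_forall fun x m n hmn =>
        tsub_le_tsub_left (antitone_expNeg (hmono x hmn)) 1)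
      (Eventually.of_forall fun x => ?_)
    exact ENNReal.Tendsto.sub tendsto_const_nhds ((continuous_expNeg.tendsto _).comp (htend x))
      (Or.inl ENNReal.one_ne_top)
  refine tendsto_nhds_unique hleft (hright.congr fun n => ?_)
  exact (hN.lintegral_expNeg_simpleFunc hNm (g n) (hfin n)).symm

end Laplace

/-! ### Link probabilities, thinning and void probabilities -/

section

instance : DecidableEq Tier := Classical.decEq _

instance : DecidableEq Link := Classical.decEq _

instance : Fintype Tier := ⟨{Tier.sbs, Tier.mbs}, fun k => by cases k <;> simp⟩

instance : Fintype Link := ⟨{Link.los, Link.nlos}, fun t => by cases t <;> simp⟩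

lemma Tier.sum_univ {M : Type*} [AddCommMonoid M] (f : Tier → M) :
    ∑ k, f k = f .sbs + f .mbs :=
  Finset.sum_pair (by simp : Tier.sbs ≠ Tier.mbs)

lemma Link.sum_univ {M : Type*} [AddCommMonoid M] (f : Link → M) :
    ∑ t, f t = f .los + f .nlos :=
  Finset.sum_pair (by simp : Link.los ≠ Link.nlos)

lemma Tier.other_ne (k : Tier) : k.other ≠ k := by cases k <;> simp [Tier.other]

lemma Link.other_ne (t : Link) : t.other ≠ t := by cases t <;> simp [Link.other]

lemma Link.eq_or_eq_other (t t' : Link) : t' = t ∨ t' = t.other := by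
  cases t <;> cases t' <;> simp [Link.other]

namespace Params

variable (par : Params)

lemma measurable_losProb : Measurable par.losProb := by
  unfold losProb
  fun_prop

lemma measurable_linkProb (t : Link) : Measurable (par.linkProb t) := by
  cases t
  · exact par.measurable_losProb
  · exact measurable_const.sub par.measurable_losProb

lemma losProb_mem_Icc {r : ℝ} (hr : 0 ≤ r) : par.losProb r ∈ Set.Icc (0 : ℝ) 1 := by
  have h1 : Real.exp (-(par.β * r)) ≤ 1 :=
    Real.exp_le_one_iff.2 (neg_nonpos.2 (mul_nonneg par.β_nonneg hr))
  have h2 : 0 ≤ min (18 / r) 1 := le_min (by positivity) zero_le_one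
  have h3 : min (18 / r) 1 ≤ 1 := min_le_right _ _
  have h4 := Real.exp_pos (-(par.β * r))
  unfold losProb
  constructor
  · have := mul_nonneg h2 (sub_nonneg.2 h1)
    linarith
  · nlinarith

lemma linkProb_nonneg (t : Link) {r : ℝ} (hr : 0 ≤ r) : 0 ≤ par.linkProb t r := by
  have := par.losProb_mem_Icc hr
  cases t
  · exact this.1
  · exact sub_nonneg.2 this.2

lemma linkProb_add_other (t : Link) (r : ℝ) :
    par.linkProb t r + par.linkProb t.other r = 1 := by
  cases t <;> simp [linkProb, Link.other]

lemma sum_ofReal_linkProb {r : ℝ} (hr : 0 ≤ r) :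
    ∑ t, ENNReal.ofReal (par.linkProb t r) = 1 := by
  rw [Link.sum_univ, ← ENNReal.ofReal_add (par.linkProb_nonneg _ hr) (par.linkProb_nonneg _ hr),
    show par.linkProb .los r + par.linkProb .nlos r = 1 from par.linkProb_add_other .los r,
    ENNReal.ofReal_one]

/-- The expected number of base stations of tier `k` with link state `t` in `D`. -/
def meanCount (k : Tier) (t : Link) (D : Set Plane) : ℝ≥0∞ :=
  (par.lam k).toNNReal * ∫⁻ x in D, ENNReal.ofReal (par.linkProb t ‖x‖)

lemma meanCount_union (k : Tier) (t : Link) {D E : Set Plane} (hE : MeasurableSet E)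
    (h : Disjoint D E) :
    par.meanCount k t (D ∪ E) = par.meanCount k t D + par.meanCount k t E := by
  rw [meanCount, lintegral_union hE h, mul_add, meanCount, meanCount]

@[simp] lemma meanCount_empty (k : Tier) (t : Link) : par.meanCount k t ∅ = 0 := by
  simp [meanCount]

/-- The conditional probability that a base station of tier `k` at `x` does not lie in the set
`D k t`, where `t` is its link state. -/
def avoidProb (D : Tier → Link → Set Plane) (k : Tier) (x : Plane) : ℝ≥0∞ :=
  ∑ t, ENNReal.ofReal (par.linkProb t ‖x‖) * (D k t)ᶜ.indicator 1 x

lemma one_sub_avoidProb (D : Tier → Link → Set Plane) (k : Tier) (x : Plane) :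
    1 - par.avoidProb D k x
      = ∑ t, (D k t).indicator (fun x => ENNReal.ofReal (par.linkProb t ‖x‖)) x := by
  refine ENNReal.sub_eq_of_eq_add_rev ?_ ?_
  · refine (ENNReal.sum_lt_top.2 fun t _ => ENNReal.mul_lt_top ENNReal.ofReal_lt_top ?_).ne
    by_cases hx : x ∈ D k t <;> simp [hx]
  · rw [avoidProb, ← Finset.sum_add_distrib, ← par.sum_ofReal_linkProb (norm_nonneg x)]
    refine Finset.sum_congr rfl fun t _ => ?_
    by_cases hx : x ∈ D k t <;> simp [hx]

lemma avoidProb_le_one (D : Tier → Link → Set Plane) (k : Tier) (x : Plane) :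
    par.avoidProb D k x ≤ 1 := by
  rw [← par.sum_ofReal_linkProb (norm_nonneg x)]
  refine Finset.sum_le_sum fun t _ => ?_
  by_cases hx : x ∈ D k t <;> simp [hx]

lemma measurable_ofReal_linkProb_norm (t : Link) :
    Measurable fun x : Plane => ENNReal.ofReal (par.linkProb t ‖x‖) :=
  ((par.measurable_linkProb t).comp measurable_norm).ennreal_ofReal

lemma measurable_avoidProb {D : Tier → Link → Set Plane} (hD : ∀ k t, MeasurableSet (D k t))
    (k : Tier) : Measurable (par.avoidProb D k) :=
  Finset.measurable_sum _ fun t _ => (par.measurable_ofReal_linkProb_norm t).mul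
    (measurable_one.indicator (hD k t).compl)

/-- The exponent of the Laplace functional splits additively over the link states. This is the
source of the independence of the two states within one tier. -/
lemma lintegral_one_sub_avoidProb {D : Tier → Link → Set Plane}
    (hD : ∀ k t, MeasurableSet (D k t)) (k : Tier) :
    (par.lam k).toNNReal * ∫⁻ x, (1 - par.avoidProb D k x) = ∑ t, par.meanCount k t (D k t) := by
  simp_rw [one_sub_avoidProb, meanCount]
  rw [lintegral_finsetSum _ fun t _ =>
    (par.measurable_ofReal_linkProb_norm t).indicator (hD k t), Finset.mul_sum]
  simp_rw [lintegral_indicator (hD _ _)]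

end Params

variable {Ω : Type*} [MeasurableSpace Ω] {P : Measure Ω}
  {par : Params} {X : Tier → ℕ → Ω → Plane} {S : Tier → ℕ → Ω → Link}

lemma measurable_pointMeasure {x : ℕ → Ω → Plane} (hx : ∀ i, Measurable (x i)) :
    Measurable fun ω => pointMeasure fun i => x i ω := by
  refine Measure.measurable_of_measurable_coe _ fun A hA => ?_
  simp_rw [pointMeasure, Measure.sum_apply _ hA]
  exact Measurable.tsum fun i =>
    ((Measure.measurable_coe hA).comp Measure.measurable_dirac).comp (hx i)

lemma lintegral_pointMeasure (x : ℕ → Plane) (f : Plane → ℝ≥0∞) :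
    ∫⁻ y, f y ∂pointMeasure x = ∑' i, f (x i) := by
  rw [pointMeasure, lintegral_sum_measure]
  simp_rw [lintegral_dirac]

namespace IsHetNet

/-- Once the states on `I` are fixed, avoidance is an event of the positions and `links` applies.
Summing over all assignments of states turns the sum of products into the product of the sums
`avoidProb`. -/
lemma measure_avoid_finset (h : IsHetNet par P X S) {D : Tier → Link → Set Plane}
    (hD : ∀ k t, MeasurableSet (D k t)) (I : Finset (Tier × ℕ)) :
    P {ω | ∀ q ∈ I, X q.1 q.2 ω ∉ D q.1 (S q.1 q.2 ω)}
      = ∫⁻ ω, ∏ q ∈ I, par.avoidProb D q.1 (X q.1 q.2 ω) ∂P := by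
  set W := {ω | ∀ q ∈ I, X q.1 q.2 ω ∉ D q.1 (S q.1 q.2 ω)} with hW
  set F : Ω → I → Link := fun ω q => S q.1.1 q.1.2 ω with hF
  have hFm : Measurable F := measurable_pi_lambda _ fun q => h.measurable_link _ _
  -- `links` takes an assignment on all indices but reads it only on `I`, so the value off `I` is
  -- arbitrary.
  set ext : (I → Link) → Tier × ℕ → Link :=
    fun s q => if hq : q ∈ I then s ⟨q, hq⟩ else .los with hext
  have hexts : ∀ s (q : I), ext s q = s q := fun s q => by simp [hext]
  set E : (I → Link) → Set Ω := fun s => ⋂ q : I, X q.1.1 q.1.2 ⁻¹' (D q.1.1 (s q))ᶜ with hE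
  have hEσ : ∀ s, MeasurableSet[⨆ (k : Tier) (i : ℕ),
      MeasurableSpace.comap (X k i) inferInstance] (E s) := fun s =>
    MeasurableSet.iInter fun q => le_iSup₂ (f := fun (k : Tier) (i : ℕ) =>
      MeasurableSpace.comap (X k i) inferInstance) q.1.1 q.1.2 _ ⟨_, (hD _ _).compl, rfl⟩
  have hEm : ∀ s, MeasurableSet (E s) := fun s =>
    MeasurableSet.iInter fun q => h.measurable_pos _ _ (hD _ _).compl
  have h1 : ∀ s, P (F ⁻¹' {s} ∩ W) = ∫⁻ ω, ∏ q : I,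
      ENNReal.ofReal (par.linkProb (s q) ‖X q.1.1 q.1.2 ω‖)
        * (D q.1.1 (s q))ᶜ.indicator 1 (X q.1.1 q.1.2 ω) ∂P := by
    intro s
    have hset : F ⁻¹' {s} ∩ W = E s ∩ {ω | ∀ q ∈ I, S q.1 q.2 ω = ext s q} := by
      ext ω
      simp only [hF, hW, hE, Set.mem_inter_iff, Set.mem_preimage, Set.mem_singleton_iff,
        funext_iff, Set.mem_ofPred_eq, Set.mem_iInter, Set.mem_compl_iff, Subtype.forall]
      constructor
      · rintro ⟨ha, hb⟩
        exact ⟨fun q hq => by rw [← ha q hq]; exact hb q hq,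
          fun q hq => by rw [ha q hq]; exact (hexts s ⟨q, hq⟩).symm⟩
      · rintro ⟨ha, hb⟩
        have hc : ∀ q (hq : q ∈ I), S q.1 q.2 ω = s ⟨q, hq⟩ := fun q hq =>
          (hb q hq).trans (hexts s ⟨q, hq⟩)
        exact ⟨hc, fun q hq => by rw [hc q hq]; exact ha q hq⟩
    rw [hset, h.links I (ext s) (E s) (hEσ s), ← lintegral_indicator (hEm s)]
    refine lintegral_congr fun ω => ?_
    rw [Finset.prod_mul_distrib]
    by_cases hω : ω ∈ E s
    · rw [Set.indicator_of_mem hω, ← Finset.prod_coe_sort I]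
      simp only [hE, Set.mem_iInter, Set.mem_preimage] at hω
      rw [Finset.prod_congr rfl (fun q _ => Set.indicator_of_mem (hω q) 1)]
      simp only [hexts, Pi.one_apply, Finset.prod_const_one, mul_one]
    -- Some position lies in its forbidden region, and the corresponding factor vanishes.
    · rw [Set.indicator_of_notMem hω]
      simp only [hE, Set.mem_iInter, Set.mem_preimage, not_forall] at hω
      obtain ⟨q, hq⟩ := hω
      rw [Finset.prod_eq_zero (i := q) (s := Finset.univ)
        (f := fun q : I => (D q.1.1 (s q))ᶜ.indicator (1 : Plane → ℝ≥0∞) (X q.1.1 q.1.2 ω))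
        (Finset.mem_univ q) (Set.indicator_of_notMem hq _), mul_zero]
  have h2 := sum_measure_preimage_singleton (μ := P.restrict W) (f := F) Finset.univ
    fun s _ => hFm (measurableSet_singleton s)
  rw [Finset.coe_univ, Set.preimage_univ, Measure.restrict_apply_univ] at h2
  rw [← h2]
  have hXm : ∀ q : Tier × ℕ, Measurable (X q.1 q.2) := fun q => h.measurable_pos _ _
  calc ∑ s, P.restrict W (F ⁻¹' {s}) = ∑ s, ∫⁻ ω, ∏ q : I,
          ENNReal.ofReal (par.linkProb (s q) ‖X q.1.1 q.1.2 ω‖)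
            * (D q.1.1 (s q))ᶜ.indicator 1 (X q.1.1 q.1.2 ω) ∂P :=
        Finset.sum_congr rfl fun s _ => by
          rw [Measure.restrict_apply (hFm (measurableSet_singleton s)), h1]
    _ = ∫⁻ ω, ∑ s : I → Link, ∏ q : I,
          ENNReal.ofReal (par.linkProb (s q) ‖X q.1.1 q.1.2 ω‖)
            * (D q.1.1 (s q))ᶜ.indicator 1 (X q.1.1 q.1.2 ω) ∂P := by
        refine (lintegral_finsetSum _ fun s _ => Finset.measurable_prod _ fun q _ => ?_).symm
        exact ((par.measurable_ofReal_linkProb_norm _).mul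
          (measurable_one.indicator (hD _ _).compl)).comp (hXm q)
    _ = _ := by
        refine lintegral_congr fun ω => ?_
        rw [← Finset.prod_coe_sort I]
        simp only [Params.avoidProb]
        rw [Finset.prod_univ_sum, Fintype.piFinset_univ]

/-- The void probabilities of the four processes of base stations of given tier and link state. -/
theorem measure_avoid [IsProbabilityMeasure P] (h : IsHetNet par P X S)
    {D : Tier → Link → Set Plane} (hD : ∀ k t, MeasurableSet (D k t)) :
    P {ω | ∀ k i, X k i ω ∉ D k (S k i ω)} = ∏ k, ∏ t, expNeg (par.meanCount k t (D k t)) := by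
  have hXm := h.measurable_pos
  -- With `f = -log a` the products over the stations become exponentials of sums, that is, of
  -- integrals against the point measures. The value `∞` occurs where `avoidProb` vanishes.
  set f : Tier → Plane → ℝ≥0∞ := fun k x => negLog (par.avoidProb D k x) with hf
  have hfm : ∀ k, Measurable (f k) := fun k =>
    measurable_negLog.comp (par.measurable_avoidProb hD k)
  have hef : ∀ k x, expNeg (f k x) = par.avoidProb D k x := fun k x =>
    expNeg_negLog (par.avoidProb_le_one D k x)
  set I : ℕ → Finset (Tier × ℕ) := fun n => Finset.univ ×ˢ Finset.range n with hI
  set V : ℕ → Set Ω := fun n => {ω | ∀ q ∈ I n, X q.1 q.2 ω ∉ D q.1 (S q.1 q.2 ω)} with hV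
  have hVm : ∀ n, MeasurableSet (V n) := fun n => by
    have : V n = ⋂ q ∈ I n, ⋃ t, S q.1 q.2 ⁻¹' {t} ∩ X q.1 q.2 ⁻¹' (D q.1 t)ᶜ := by
      ext ω
      simp [hV]
    rw [this]
    exact Finset.measurableSet_biInter _ fun q _ => MeasurableSet.iUnion fun t =>
      (h.measurable_link _ _ (measurableSet_singleton t)).inter (hXm _ _ (hD _ _).compl)
  have hVanti : Antitone V := fun m n hmn ω hω q hq => hω q (by
    simp only [hI, Finset.mem_product, Finset.mem_univ, Finset.mem_range, true_and] at hq ⊢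
    omega)
  have hVinter : ⋂ n, V n = {ω | ∀ k i, X k i ω ∉ D k (S k i ω)} := by
    ext ω
    simp only [hV, hI, Set.mem_iInter, Set.mem_ofPred_eq, Finset.mem_product, Finset.mem_univ,
      Finset.mem_range, true_and, Prod.forall]
    exact ⟨fun H k i => H (i + 1) k i (Nat.lt_succ_self i), fun H n k i _ => H k i⟩
  have hleft : Tendsto (fun n => P (V n)) atTop
      (𝓝 (P {ω | ∀ k i, X k i ω ∉ D k (S k i ω)})) := by
    rw [← hVinter]
    exact tendsto_measure_iInter_atTop (fun n => (hVm n).nullMeasurableSet) hVanti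
      ⟨0, measure_ne_top _ _⟩
  have hPV : ∀ n, P (V n)
      = ∫⁻ ω, expNeg (∑ k, ∑ i ∈ Finset.range n, f k (X k i ω)) ∂P := fun n => by
    rw [hV, h.measure_avoid_finset hD]
    refine lintegral_congr fun ω => ?_
    rw [← Finset.sum_product', expNeg_sum]
    exact Finset.prod_congr rfl fun q _ => (hef _ _).symm
  have hright : Tendsto (fun n => P (V n)) atTop
      (𝓝 (∫⁻ ω, expNeg (∑ k, ∑' i, f k (X k i ω)) ∂P)) := by
    simp_rw [hPV]
    refine tendsto_lintegral_of_dominated_convergence (fun _ => 1) (fun n => ?_)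
      (fun n => Eventually.of_forall fun ω => expNeg_le_one _) (by simp)
      (Eventually.of_forall fun ω => (continuous_expNeg.tendsto _).comp ?_)
    · exact measurable_expNeg.comp (Finset.measurable_sum _ fun k _ =>
        Finset.measurable_sum _ fun i _ => (hfm k).comp (hXm k i))
    · exact tendsto_finsetSum _ fun k _ => ENNReal.tendsto_nat_tsum _
  rw [tendsto_nhds_unique hleft hright]
  -- Each factor depends only on the point measure of one tier, which is the level at which the
  -- tiers are assumed independent.
  set Z : Tier → Measure Plane → ℝ≥0∞ := fun k μ => expNeg (∫⁻ x, f k x ∂μ) with hZ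
  have hZm : ∀ k, Measurable (Z k) := fun k =>
    measurable_expNeg.comp (Measure.measurable_lintegral (hfm k))
  have hN : ∀ k, Measurable fun ω => pointMeasure fun i => X k i ω := fun k =>
    measurable_pointMeasure (hXm k)
  have hint : ∀ k, ∫⁻ ω, Z k (pointMeasure fun i => X k i ω) ∂P
      = ∏ t, expNeg (par.meanCount k t (D k t)) := fun k => by
    rw [(h.poisson k).lintegral_expNeg (hN k) (hfm k)]
    simp_rw [hef]
    rw [par.lintegral_one_sub_avoidProb hD, expNeg_sum]
  have hprod : ∀ g : Tier → ℝ≥0∞, ∏ k, g k = g .sbs * g .mbs := fun g =>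
    Finset.prod_pair (by simp : Tier.sbs ≠ Tier.mbs)
  rw [hprod, ← hint, ← hint]
  refine Eq.trans (lintegral_congr fun ω => ?_)
    (lintegral_mul_eq_lintegral_mul_lintegral_of_indepFun ((hZm _).comp (hN _))
      ((hZm _).comp (hN _)) (h.indep.comp (hZm .sbs) (hZm .mbs)))
  simp only [hZ, Pi.mul_apply, lintegral_pointMeasure, Tier.sum_univ,
    expNeg_add]

/-- The void probabilities of the process of base stations of one tier and link state. -/
lemma measure_avoid_single [IsProbabilityMeasure P] (h : IsHetNet par P X S) (k : Tier) (t : Link)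
    {D : Set Plane} (hD : MeasurableSet D) :
    P {ω | ∀ i, S k i ω = t → X k i ω ∉ D} = expNeg (par.meanCount k t D) := by
  have := h.measure_avoid (D := fun k' t' => if k' = k ∧ t' = t then D else ∅)
    fun k' t' => by split_ifs <;> simp [hD]
  rw [Finset.prod_eq_single k, Finset.prod_eq_single t] at this
  · rw [if_pos ⟨rfl, rfl⟩] at this
    rw [← this]
    congr 1
    ext ω
    constructor
    · intro H k' i
      split_ifs with hc
      · obtain ⟨rfl, hc⟩ := hc
        exact H i hc
      · simp
    · intro H i hi
      simpa [hi] using H k i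
  · intro t' _ ht'
    simp [ht']
  · simp
  · intro k' _ hk'
    exact Finset.prod_eq_one fun t' _ => by simp [hk']
  · simp

end IsHetNet

end

/-! ### Distances to the nearest stations of the four types -/

section

/-- The distance to the nearest base station of tier `k` with link state `t`, with value `∞` if
there is none. -/
def typeDist {Ω : Type*} (X : Tier → ℕ → Ω → Plane) (S : Tier → ℕ → Ω → Link) (k : Tier)
    (t : Link) (ω : Ω) : ℝ≥0∞ :=
  ⨅ i, ⨅ (_ : S k i ω = t), ‖X k i ω‖ₑ

/-- The open ball around the origin of extended radius `a`. -/
def originBall (a : ℝ≥0∞) : Set Plane := {x | ‖x‖ₑ < a}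

lemma measurableSet_originBall (a : ℝ≥0∞) : MeasurableSet (originBall a) :=
  measurableSet_lt measurable_enorm measurable_const

variable {Ω : Type*} {X : Tier → ℕ → Ω → Plane} {S : Tier → ℕ → Ω → Link}

lemma le_typeDist_iff {k : Tier} {t : Link} {a : ℝ≥0∞} {ω : Ω} :
    a ≤ typeDist X S k t ω ↔ ∀ i, S k i ω = t → X k i ω ∉ originBall a := by
  simp [typeDist, originBall]

lemma typeDist_le (k : Tier) (i : ℕ) (ω : Ω) :
    typeDist X S k (S k i ω) ω ≤ ‖X k i ω‖ₑ :=
  iInf₂_le (f := fun j (_ : S k j ω = S k i ω) => ‖X k j ω‖ₑ) i rfl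

variable [MeasurableSpace Ω] {P : Measure Ω} {par : Params}

namespace IsHetNet

lemma measurable_typeDist (h : IsHetNet par P X S) (k : Tier) (t : Link) :
    Measurable (typeDist X S k t) := by
  unfold typeDist
  refine Measurable.iInf fun i => ?_
  simp_rw [iInf_eq_if]
  exact Measurable.ite (h.measurable_link k i (measurableSet_singleton t))
    (h.measurable_pos k i).enorm measurable_const

section Law

variable [IsProbabilityMeasure P]

lemma measure_le_typeDist (h : IsHetNet par P X S) (k : Tier) (t : Link) (a : ℝ≥0∞) :
    P {ω | a ≤ typeDist X S k t ω} = expNeg (par.meanCount k t (originBall a)) := by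
  simp_rw [le_typeDist_iff]
  exact h.measure_avoid_single k t (measurableSet_originBall a)

/-- The distances to the nearest base stations of the various types are independent. -/
lemma iIndepFun_typeDist (h : IsHetNet par P X S) :
    iIndepFun (fun (τ : Tier × Link) => typeDist X S τ.1 τ.2) P := by
  rw [iIndepFun_iff_iIndep]
  -- The rays `[a, ∞]` form a generating π-system, and `a ≤ R_τ` says that type `τ` avoids the ball
  -- of radius `a`.
  refine iIndepSets.iIndep (fun τ => (h.measurable_typeDist τ.1 τ.2).comap_le)
    (fun τ => Set.preimage (typeDist X S τ.1 τ.2) '' Set.range Set.Ici)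
    (fun τ => isPiSystem_Ici.comap _) (fun τ => ?_) ?_
  · rw [← MeasurableSpace.comap_generateFrom, ← borel_eq_generateFrom_Ici,
      ← BorelSpace.measurable_eq]
  · rw [iIndepSets_iff]
    intro s f hf
    -- Types outside `s` get radius `0`, hence an empty ball, so that the intersection is a single
    -- avoidance event for all four types.
    have hf' : ∀ τ : Tier × Link, ∃ a : ℝ≥0∞, (τ ∈ s → f τ = {ω | a ≤ typeDist X S τ.1 τ.2 ω})
        ∧ (τ ∉ s → a = 0) := by
      intro τ
      by_cases hτ : τ ∈ s
      · obtain ⟨_, ⟨a, rfl⟩, ha⟩ := hf τ hτ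
        exact ⟨a, fun _ => ha.symm, fun hn => absurd hτ hn⟩
      · exact ⟨0, fun hn => absurd hn hτ, fun _ => rfl⟩
    choose a ha ha0 using hf'
    have hset : ⋂ τ ∈ s, f τ
        = {ω | ∀ k i, X k i ω ∉ originBall (a (k, S k i ω))} := by
      ext ω
      rw [Set.mem_iInter₂]
      constructor
      · intro H k i
        by_cases hτ : (k, S k i ω) ∈ s
        · have := H _ hτ
          rw [ha _ hτ] at this
          exact le_typeDist_iff.1 this i rfl
        · simp [ha0 _ hτ, originBall]
      · intro H τ hτ
        rw [ha _ hτ]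
        exact le_typeDist_iff.2 fun i hi => by
          have := H τ.1 i
          rwa [hi] at this
    rw [hset, h.measure_avoid (D := fun k t => originBall (a (k, t)))
      fun k t => measurableSet_originBall _,
      ← Fintype.prod_prod_type'
        (f := fun k t => expNeg (par.meanCount k t (originBall (a (k, t)))))]
    refine (Finset.prod_subset (Finset.subset_univ s) fun τ _ hτ => ?_).symm.trans
      (Finset.prod_congr rfl fun τ hτ => ?_)
    · simp [ha0 _ hτ, originBall]
    · rw [ha _ hτ, h.measure_le_typeDist]

/-- A single point has area zero. Distance `0` has to be excluded because there the real power `0 ^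
(-α)` is `0` by convention, not infinite. -/
lemma ae_ne_zero (h : IsHetNet par P X S) : ∀ᵐ ω ∂P, ∀ k i, X k i ω ≠ 0 := by
  have hE := h.measure_avoid (D := fun _ _ => {0}) fun _ _ => measurableSet_singleton _
  have h0 : ∀ k t, par.meanCount k t {0} = 0 := fun k t => by
    rw [Params.meanCount, Measure.restrict_eq_zero.2 (measure_singleton 0)]
    simp
  simp only [h0, expNeg_zero, Finset.prod_const_one] at hE
  have hm : MeasurableSet {ω | ∀ k i, X k i ω ∉ ({0} : Set Plane)} := by
    have : {ω | ∀ k i, X k i ω ∉ ({0} : Set Plane)} = ⋂ k, ⋂ i, X k i ⁻¹' {0}ᶜ := by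
      ext ω
      simp
    rw [this]
    exact MeasurableSet.iInter fun k => MeasurableSet.iInter fun i =>
      h.measurable_pos k i (measurableSet_singleton _).compl
  exact (prob_compl_eq_zero_iff hm).2 hE

end Law

/-- Every index in the ball adds `1` to the count of the ball, which is almost surely finite. This
makes the infimum defining `typeDist` a minimum. -/
lemma ae_finite_ball (h : IsHetNet par P X S) :
    ∀ᵐ ω ∂P, ∀ (k : Tier) (n : ℕ), {i | X k i ω ∈ Metric.ball (0 : Plane) n}.Finite := by
  refine ae_all_iff.2 fun k => ae_all_iff.2 fun n => ?_
  have hN := measurable_pointMeasure (h.measurable_pos k)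
  filter_upwards [(h.poisson k).ae_lt_top hN (A := Metric.ball (0 : Plane) n)
    measurableSet_ball measure_ball_lt_top.ne] with ω hω
  rw [pointMeasure, Measure.sum_apply _ measurableSet_ball] at hω
  refine (ENNReal.finite_const_le_of_tsum_ne_top hω.ne one_ne_zero).subset fun i hi => ?_
  have hi' : X k i ω ∈ Metric.ball (0 : Plane) n := hi
  simp [Measure.dirac_apply' _ (measurableSet_ball (x := (0 : Plane)) (ε := n)), hi',
    -Metric.mem_ball]

/-- The distance to the nearest base station of a given type is attained unless there is none. -/
lemma ae_typeDist_attained (h : IsHetNet par P X S) :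
    ∀ᵐ ω ∂P, ∀ k t, typeDist X S k t ω < ∞ →
      ∃ i, S k i ω = t ∧ ‖X k i ω‖ₑ = typeDist X S k t ω := by
  filter_upwards [h.ae_finite_ball] with ω hω k t hlt
  obtain ⟨n, hn⟩ := ENNReal.exists_nat_gt hlt.ne
  have hmem : ∀ i, X k i ω ∈ Metric.ball (0 : Plane) n ↔ ‖X k i ω‖ₑ < n := fun i => by
    rw [mem_ball_zero_iff, ← ENNReal.ofReal_natCast n, ← ofReal_norm,
      ENNReal.ofReal_lt_ofReal_iff_of_nonneg (norm_nonneg _)]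
  obtain ⟨j, hj⟩ := iInf_lt_iff.1 hn
  obtain ⟨hjt, hjn⟩ := iInf_lt_iff.1 hj
  -- Only the finitely many stations within a radius `n` above the infimum compete.
  obtain ⟨i, ⟨hit, hin⟩, hmin⟩ := Set.exists_min_image
    {i | S k i ω = t ∧ X k i ω ∈ Metric.ball (0 : Plane) n} (fun i => ‖X k i ω‖ₑ)
    ((hω k n).subset fun i hi => hi.2) ⟨j, hjt, (hmem j).2 hjn⟩
  refine ⟨i, hit, le_antisymm (le_iInf₂ fun l hl => ?_) (iInf₂_le i hit)⟩
  by_cases hln : ‖X k l ω‖ₑ < n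
  · exact hmin l ⟨hl, (hmem l).2 hln⟩
  · exact ((hmem i).1 hin).le.trans (not_lt.1 hln)

end IsHetNet

namespace Params

variable (par)

/-- The expected number of base stations of tier `k` with link state `t` at distance less
than `r`. -/
def meanInBall (k : Tier) (t : Link) (r : ℝ) : ℝ :=
  2 * Real.pi * par.lam k * ∫ u in (0 : ℝ)..r, par.linkProb t u * u

lemma linkProb_le_one (t : Link) {r : ℝ} (hr : 0 ≤ r) : par.linkProb t r ≤ 1 := by
  have := par.linkProb_add_other t r
  have := par.linkProb_nonneg t.other hr
  linarith

lemma intervalIntegrable_linkProb_mul (t : Link) {a b : ℝ} (ha : 0 ≤ a) (hab : a ≤ b) :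
    IntervalIntegrable (fun u => par.linkProb t u * u) volume a b := by
  refine (intervalIntegrable_const (c := b)).mono_fun
    ((par.measurable_linkProb t).mul measurable_id).aestronglyMeasurable ?_
  rw [Set.uIoc_of_le hab]
  refine (ae_restrict_mem measurableSet_Ioc).mono fun u hu => ?_
  have hu0 : 0 ≤ u := ha.trans hu.1.le
  beta_reduce
  rw [Real.norm_of_nonneg (mul_nonneg (par.linkProb_nonneg t hu0) hu0),
    Real.norm_of_nonneg (ha.trans hab)]
  exact (mul_le_of_le_one_left hu0 (par.linkProb_le_one t hu0)).trans hu.2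

lemma continuousAt_linkProb (t : Link) {r : ℝ} (hr : 0 < r) :
    ContinuousAt (par.linkProb t) r := by
  have : ContinuousAt par.losProb r := by
    unfold losProb
    have : r ≠ 0 := hr.ne'
    fun_prop (disch := assumption)
  cases t
  · exact this
  · exact continuousAt_const.sub this

lemma meanInBall_nonneg (k : Tier) (t : Link) {r : ℝ} (hr : 0 ≤ r) :
    0 ≤ par.meanInBall k t r := by
  have := par.lam_pos k
  refine mul_nonneg (by positivity) (intervalIntegral.integral_nonneg hr fun u hu => ?_)
  exact mul_nonneg (par.linkProb_nonneg t hu.1) hu.1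

lemma meanInBall_add_other (k : Tier) (t : Link) {r : ℝ} (hr : 0 ≤ r) :
    par.meanInBall k t r + par.meanInBall k t.other r = Real.pi * r ^ 2 * par.lam k := by
  rw [meanInBall, meanInBall, ← mul_add, ← intervalIntegral.integral_add
    (par.intervalIntegrable_linkProb_mul t le_rfl hr)
    (par.intervalIntegrable_linkProb_mul t.other le_rfl hr)]
  simp_rw [← add_mul, linkProb_add_other, one_mul, integral_id]
  ring

lemma hasDerivAt_meanInBall (k : Tier) (t : Link) {r : ℝ} (hr : 0 < r) :
    HasDerivAt (par.meanInBall k t) (2 * Real.pi * par.lam k * (par.linkProb t r * r)) r :=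
  (intervalIntegral.integral_hasDerivAt_right
    (par.intervalIntegrable_linkProb_mul t le_rfl hr.le)
    ((par.measurable_linkProb t).mul measurable_id).stronglyMeasurable.stronglyMeasurableAtFilter
    ((par.continuousAt_linkProb t hr).mul continuousAt_id)).const_mul _

lemma nearestOfTypeDensity_eq (k : Tier) (t : Link) (r : ℝ) :
    par.nearestOfTypeDensity k t r
      = par.linkProb t r * Real.exp (-par.meanInBall k t r) * (2 * Real.pi * r * par.lam k) :=
  rfl

lemma nearestOfTypeDensity_nonneg (k : Tier) (t : Link) {r : ℝ} (hr : 0 ≤ r) :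
    0 ≤ par.nearestOfTypeDensity k t r := by
  have := par.lam_pos k
  have := par.linkProb_nonneg t hr
  rw [nearestOfTypeDensity_eq]
  positivity

/-- The nearest station of the tier has state `t` when it is the nearest of its type and no station
of the other state is nearer. The exponentials combine because the two means add up to `πr²λ`. -/
lemma exp_neg_meanInBall_other_mul (k : Tier) (t : Link) {r : ℝ} (hr : 0 ≤ r) :
    Real.exp (-par.meanInBall k t.other r) * par.nearestOfTypeDensity k t r
      = par.nearestDensity k t r := by
  rw [nearestOfTypeDensity_eq, nearestDensity, ← par.meanInBall_add_other k t hr, neg_add,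
    Real.exp_add]
  ring

/-- The integrand is the derivative of `-exp(-Λ)`. Its integrability comes from its sign, and
continuity suffices at the endpoints, in particular at `0`. -/
lemma lintegral_nearestOfTypeDensity (k : Tier) (t : Link) {a b : ℝ} (ha : 0 ≤ a)
    (hab : a ≤ b) :
    ∫⁻ r in Set.Ioc a b, ENNReal.ofReal (par.nearestOfTypeDensity k t r)
      = ENNReal.ofReal (Real.exp (-par.meanInBall k t a) - Real.exp (-par.meanInBall k t b)) := by
  have hb : 0 ≤ b := ha.trans hab
  have hcont : ContinuousOn (fun r => -Real.exp (-par.meanInBall k t r)) (Set.Icc a b) := by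
    have h := intervalIntegral.continuousOn_primitive_interval'
      (par.intervalIntegrable_linkProb_mul t le_rfl hb) Set.left_mem_uIcc
    rw [Set.uIcc_of_le hb] at h
    have h2 : ContinuousOn (par.meanInBall k t) (Set.Icc a b) :=
      (continuousOn_const.mul h).mono (Set.Icc_subset_Icc_left ha)
    exact (Real.continuous_exp.comp_continuousOn h2.neg).neg
  have hderiv : ∀ r ∈ Set.Ioo a b, HasDerivAt (fun r => -Real.exp (-par.meanInBall k t r))
      (par.nearestOfTypeDensity k t r) r := fun r hr => by
    refine ((par.hasDerivAt_meanInBall k t (ha.trans_lt hr.1)).neg.exp.neg).congr_deriv ?_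
    rw [nearestOfTypeDensity_eq]
    simp only [Pi.neg_apply]
    ring
  have hint := intervalIntegral.integrableOn_deriv_of_nonneg hcont hderiv fun _ hr =>
    par.nearestOfTypeDensity_nonneg k t (ha.trans hr.1.le)
  rw [← ofReal_integral_eq_lintegral_ofReal hint ((ae_restrict_mem measurableSet_Ioc).mono
      fun r hr => par.nearestOfTypeDensity_nonneg k t (ha.trans hr.1.le)),
    ← intervalIntegral.integral_of_le hab,
    intervalIntegral.integral_eq_sub_of_hasDerivAt_of_le hab hcont hderiv
      ((intervalIntegrable_iff_integrableOn_Ioc_of_le hab).2 hint)]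
  congr 1
  ring

lemma originBall_ofReal (r : ℝ) :
    originBall (ENNReal.ofReal r) = Metric.ball 0 r := by
  ext x
  rw [originBall, Set.mem_ofPred_eq, mem_ball_zero_iff, ← ofReal_norm,
    ENNReal.ofReal_lt_ofReal_iff_of_nonneg (norm_nonneg _)]

lemma meanCount_originBall (k : Tier) (t : Link) {r : ℝ} (hr : 0 ≤ r) :
    par.meanCount k t (originBall (ENNReal.ofReal r)) = ENNReal.ofReal (par.meanInBall k t r) := by
  have hint : IntegrableOn (fun x : Plane => par.linkProb t ‖x‖) (Metric.ball 0 r) :=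
    Measure.integrableOn_of_bounded (M := 1) measure_ball_lt_top.ne
      ((par.measurable_linkProb t).comp measurable_norm).aestronglyMeasurable
      (Eventually.of_forall fun x => by
        rw [Real.norm_of_nonneg (par.linkProb_nonneg t (norm_nonneg x))]
        exact par.linkProb_le_one t (norm_nonneg x))
  have hpolar : ∫ x in Metric.ball (0 : Plane) r, par.linkProb t ‖x‖
      = 2 * Real.pi * ∫ u in (0 : ℝ)..r, par.linkProb t u * u := by
    -- Polar coordinates: the indicator makes the integrand radial on the whole plane, and dimension
    -- `2` times the unit disc area `π` gives the factor `2π`.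
    have h := integral_fun_norm_addHaar (volume : Measure Plane)
      ((Set.Iio r).indicator (par.linkProb t))
    have h1 : ∀ x : Plane, (Set.Iio r).indicator (par.linkProb t) ‖x‖
        = (Metric.ball (0 : Plane) r).indicator (fun x => par.linkProb t ‖x‖) x := fun x => by
      by_cases hx : ‖x‖ < r <;> simp [Set.indicator, hx]
    have h2 : ∀ y : ℝ, y ^ (2 - 1) • (Set.Iio r).indicator (par.linkProb t) y
        = (Set.Iio r).indicator (fun y => par.linkProb t y * y) y := fun y => by
      by_cases hy : y < r <;> simp [Set.indicator, hy, mul_comm]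
    have hvol : volume.real (Metric.ball (0 : Plane) 1) = Real.pi := by
      rw [Measure.real, EuclideanSpace.volume_ball_fin_two]
      simp [Real.pi_pos.le]
    rw [finrank_euclideanSpace_fin, hvol] at h
    simp_rw [h1, h2] at h
    rw [integral_indicator measurableSet_ball, setIntegral_indicator measurableSet_Iio,
      Set.Ioi_inter_Iio, ← integral_Ioc_eq_integral_Ioo,
      ← intervalIntegral.integral_of_le hr] at h
    rw [h, nsmul_eq_mul, smul_eq_mul]
    push_cast
    ring
  rw [meanCount, originBall_ofReal r, ← ofReal_integral_eq_lintegral_ofReal hint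
      (Eventually.of_forall fun x => par.linkProb_nonneg t (norm_nonneg x)), hpolar,
    show ((par.lam k).toNNReal : ℝ≥0∞) = ENNReal.ofReal (par.lam k) from rfl,
    ← ENNReal.ofReal_mul (par.lam_pos k).le, meanInBall]
  congr 1
  ring

end Params

end

/-! ### Density of one distance and joint law of the four -/

section

variable {Ω : Type*} {X : Tier → ℕ → Ω → Plane} {S : Tier → ℕ → Ω → Link}
  [MeasurableSpace Ω] {P : Measure Ω} {par : Params}

/-- The positive finite extended distances whose real value lies in `B`. -/
def distanceSet (B : Set ℝ) : Set ℝ≥0∞ := Set.Ioo 0 ∞ ∩ ENNReal.toReal ⁻¹' B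

lemma measurableSet_distanceSet {B : Set ℝ} (hB : MeasurableSet B) :
    MeasurableSet (distanceSet B) :=
  measurableSet_Ioo.inter (ENNReal.measurable_toReal hB)

namespace IsHetNet

variable [IsProbabilityMeasure P]

/-- A zero infimum would be attained, by a station at the origin. -/
lemma ae_typeDist_ne_zero (h : IsHetNet par P X S) :
    ∀ᵐ ω ∂P, ∀ k t, typeDist X S k t ω ≠ 0 := by
  filter_upwards [h.ae_ne_zero, h.ae_typeDist_attained] with ω h0 hatt k t hR
  obtain ⟨i, -, hi⟩ := hatt k t (hR ▸ ENNReal.zero_lt_top)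
  rw [hR, enorm_eq_zero] at hi
  exact h0 k i hi

lemma measure_ofReal_le_typeDist (h : IsHetNet par P X S) (k : Tier) (t : Link) {r : ℝ}
    (hr : 0 ≤ r) :
    P {ω | ENNReal.ofReal r ≤ typeDist X S k t ω}
      = ENNReal.ofReal (Real.exp (-par.meanInBall k t r)) := by
  rw [h.measure_le_typeDist, par.meanCount_originBall k t hr,
    expNeg_ofReal (par.meanInBall_nonneg k t hr)]

lemma measure_typeDist_mem_Ico (h : IsHetNet par P X S) (k : Tier) (t : Link) {a b : ℝ}
    (ha : 0 ≤ a) (hab : a ≤ b) :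
    P (typeDist X S k t ⁻¹' distanceSet (Set.Ico a b))
      = ENNReal.ofReal
          (Real.exp (-par.meanInBall k t a) - Real.exp (-par.meanInBall k t b)) := by
  have hm : ∀ c : ℝ≥0∞, MeasurableSet {ω | c ≤ typeDist X S k t ω} := fun c =>
    measurableSet_le measurable_const (h.measurable_typeDist k t)
  have hsub : {ω | ENNReal.ofReal b ≤ typeDist X S k t ω}
      ⊆ {ω | ENNReal.ofReal a ≤ typeDist X S k t ω} := fun ω hω =>
    (ENNReal.ofReal_le_ofReal hab).trans hω
  -- When `a = 0` the difference of events also contains distance `0`, which `distanceSet` leaves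
  -- out; this is a null event.
  have hae : (typeDist X S k t ⁻¹' distanceSet (Set.Ico a b) : Set Ω) =ᵐ[P]
      ({ω | ENNReal.ofReal a ≤ typeDist X S k t ω}
        \ {ω | ENNReal.ofReal b ≤ typeDist X S k t ω} : Set Ω) := by
    refine Filter.eventuallyEq_set.2 ?_
    filter_upwards [h.ae_typeDist_ne_zero] with ω h0
    simp only [distanceSet, Set.mem_preimage, Set.mem_inter_iff, Set.mem_Ioo, Set.mem_Ico,
      Set.mem_sdiff, Set.mem_ofPred_eq, not_le]
    constructor
    · rintro ⟨⟨-, h1⟩, h2, h3⟩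
      exact ⟨(ENNReal.ofReal_le_iff_le_toReal h1.ne).2 h2,
        (ENNReal.lt_ofReal_iff_toReal_lt h1.ne).2 h3⟩
    · rintro ⟨h2, h3⟩
      have h1 := h3.trans ENNReal.ofReal_lt_top
      exact ⟨⟨pos_iff_ne_zero.2 (h0 k t), h1⟩, (ENNReal.ofReal_le_iff_le_toReal h1.ne).1 h2,
        (ENNReal.lt_ofReal_iff_toReal_lt h1.ne).1 h3⟩
  rw [measure_congr hae, measure_sdiff hsub (hm _).nullMeasurableSet (measure_ne_top _ _),
    h.measure_ofReal_le_typeDist k t ha, h.measure_ofReal_le_typeDist k t (ha.trans hab),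
    ENNReal.ofReal_sub _ (Real.exp_pos _).le]

/-- The law of the distance to the nearest base station of a given type. -/
lemma map_typeDist_restrict (h : IsHetNet par P X S) (k : Tier) (t : Link) :
    ((P.map (typeDist X S k t)).restrict (Set.Ioo 0 ∞)).map ENNReal.toReal
      = (volume.restrict (Set.Ioi 0)).withDensity
          fun r => ENNReal.ofReal (par.nearestOfTypeDensity k t r) := by
  have hR := h.measurable_typeDist k t
  have : IsProbabilityMeasure (P.map (typeDist X S k t)) :=
    Measure.isProbabilityMeasure_map hR.aemeasurable
  have hmap : ∀ B : Set ℝ, MeasurableSet B →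
      ((P.map (typeDist X S k t)).restrict (Set.Ioo 0 ∞)).map ENNReal.toReal B
        = P (typeDist X S k t ⁻¹' distanceSet B) := fun B hB => by
    rw [Measure.map_apply ENNReal.measurable_toReal hB,
      Measure.restrict_apply (ENNReal.measurable_toReal hB),
      Measure.map_apply hR ((ENNReal.measurable_toReal hB).inter measurableSet_Ioo),
      Set.inter_comm, distanceSet]
  -- Half-open intervals determine the measure. Distances are nonnegative, so a negative left
  -- endpoint may be raised to `0`.
  have hpos : ∀ a b : ℝ, distanceSet (Set.Ico a b) ⊆ distanceSet (Set.Ico (max a 0) b) :=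
    fun a b y hy => ⟨hy.1, max_le hy.2.1 ENNReal.toReal_nonneg, hy.2.2⟩
  refine Measure.ext_of_Ico _ _ fun a b hab => ?_
  rw [hmap _ measurableSet_Ico, withDensity_apply _ measurableSet_Ico,
    Measure.restrict_restrict measurableSet_Ico]
  have hset : (typeDist X S k t ⁻¹' distanceSet (Set.Ico a b))
      = typeDist X S k t ⁻¹' distanceSet (Set.Ico (max a 0) b) := by
    refine Set.Subset.antisymm (Set.preimage_mono (hpos a b)) (Set.preimage_mono ?_)
    exact fun y hy => ⟨hy.1, (le_max_left a 0).trans hy.2.1, hy.2.2⟩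
  have hae : (Set.Ico a b ∩ Set.Ioi 0 : Set ℝ) =ᵐ[volume] Set.Ioc (max a 0) b := by
    have h1 : (Set.Ico a b : Set ℝ) =ᵐ[volume] Set.Ioc a b := Ico_ae_eq_Ioc
    have h2 := h1.inter (ae_eq_refl (Set.Ioi (0 : ℝ)))
    rwa [Set.Ioc_inter_Ioi] at h2
  rw [hset, setLIntegral_congr hae]
  rcases le_total b 0 with hb | hb
  · have h0 : max a 0 = 0 := max_eq_right (hab.le.trans hb)
    have he : distanceSet (Set.Ico 0 b) = ∅ := by
      rw [Set.Ico_eq_empty hb.not_gt, distanceSet, Set.preimage_empty, Set.inter_empty]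
    rw [h0, he, Set.Ioc_eq_empty hb.not_gt]
    simp
  · rw [par.lintegral_nearestOfTypeDensity k t (le_max_right a 0) (max_le hab.le hb),
      h.measure_typeDist_mem_Ico k t (le_max_right a 0) (max_le hab.le hb)]

lemma setLIntegral_map_typeDist (h : IsHetNet par P X S) (k : Tier) (t : Link) {B : Set ℝ}
    (hB : MeasurableSet B) {f : ℝ≥0∞ → ℝ≥0∞} (hf : Measurable f) :
    ∫⁻ y in distanceSet B, f y ∂P.map (typeDist X S k t)
      = ∫⁻ r in B ∩ Set.Ioi 0,
          f (ENNReal.ofReal r) * ENNReal.ofReal (par.nearestOfTypeDensity k t r) := by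
  have hf' : Measurable fun r : ℝ => f (ENNReal.ofReal r) := hf.comp ENNReal.measurable_ofReal
  have hg : AEMeasurable (fun r => ENNReal.ofReal (par.nearestOfTypeDensity k t r))
      (volume.restrict (Set.Ioi 0)) := by
    have hc : ContinuousOn (par.nearestOfTypeDensity k t) (Set.Ioi 0) := fun r hr =>
      (((par.continuousAt_linkProb t hr).mul
        (par.hasDerivAt_meanInBall k t hr).continuousAt.neg.rexp).mul
          (by fun_prop)).continuousWithinAt
    exact (hc.aemeasurable measurableSet_Ioi).ennreal_ofReal
  have h1 := setLIntegral_withDensity_eq_lintegral_mul₀ hg hf'.aemeasurable hB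
  rw [← h.map_typeDist_restrict, setLIntegral_map hB hf' ENNReal.measurable_toReal,
    Measure.restrict_restrict (ENNReal.measurable_toReal hB),
    Measure.restrict_restrict hB, Set.inter_comm, ← distanceSet] at h1
  simp only [Pi.mul_apply, mul_comm (ENNReal.ofReal (par.nearestOfTypeDensity _ _ _))] at h1
  rw [← h1]
  exact setLIntegral_congr_fun (measurableSet_distanceSet hB) fun y hy => by
    rw [ENNReal.ofReal_toReal hy.1.2.ne]

/-- The joint law of the distances to the nearest base stations of the four types, in terms of the
density of one of them. -/
theorem measure_typeDist_mem (h : IsHetNet par P X S) (k : Tier) (t : Link) {B : Set ℝ}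
    (hB : MeasurableSet B) {Q : Tier × Link → Set (ℝ≥0∞ × ℝ≥0∞)}
    (hQ : ∀ τ, MeasurableSet (Q τ)) :
    P {ω | typeDist X S k t ω ∈ distanceSet B ∧ ∀ τ ∈ Finset.univ.erase (k, t),
        (typeDist X S k t ω, typeDist X S τ.1 τ.2 ω) ∈ Q τ}
      = ∫⁻ r in B ∩ Set.Ioi 0, (∏ τ ∈ Finset.univ.erase (k, t),
          P {ω | (ENNReal.ofReal r, typeDist X S τ.1 τ.2 ω) ∈ Q τ})
            * ENNReal.ofReal (par.nearestOfTypeDensity k t r) := by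
  set T : Finset (Tier × Link) := Finset.univ.erase (k, t) with hT
  have hRm : ∀ τ : Tier × Link, Measurable (typeDist X S τ.1 τ.2) := fun τ =>
    h.measurable_typeDist τ.1 τ.2
  -- The three remaining distances are jointly independent of the selected one. The joint law is
  -- thus a product, and Tonelli applies to sections at a fixed value `y` of the selected distance.
  set Y : Ω → T → ℝ≥0∞ := fun ω τ => typeDist X S τ.1.1 τ.1.2 ω with hY
  have hYm : Measurable Y := measurable_pi_lambda _ fun τ => hRm τ
  have hind : IndepFun (typeDist X S k t) Y P := by
    have h1 := h.iIndepFun_typeDist.indepFun_finset {(k, t)} T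
      (Finset.disjoint_singleton_left.2 (Finset.notMem_erase _ _)) hRm
    exact h1.comp (φ := fun y : ({(k, t)} : Finset (Tier × Link)) → ℝ≥0∞ =>
        y ⟨(k, t), Finset.mem_singleton_self _⟩) (ψ := id) (measurable_pi_apply _) measurable_id
  have hmap := (indepFun_iff_map_prod_eq_prod_map_map (hRm (k, t)).aemeasurable
    hYm.aemeasurable).1 hind
  have : IsProbabilityMeasure (P.map Y) := Measure.isProbabilityMeasure_map hYm.aemeasurable
  set A : Set (ℝ≥0∞ × (T → ℝ≥0∞)) := ⋂ τ : T, {p | (p.1, p.2 τ) ∈ Q τ} with hA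
  have hAm : MeasurableSet A := MeasurableSet.iInter fun τ =>
    (measurable_fst.prodMk ((measurable_pi_apply τ).comp measurable_snd)) (hQ τ)
  have hDm := measurableSet_distanceSet hB
  have hsec : ∀ y, P.map Y (Prod.mk y ⁻¹' A)
      = ∏ τ ∈ T, P {ω | (y, typeDist X S τ.1 τ.2 ω) ∈ Q τ} := fun y => by
    rw [Measure.map_apply hYm (measurable_prodMk_left hAm)]
    have := h.iIndepFun_typeDist.measure_inter_preimage_eq_mul T
      (sets := fun τ => Prod.mk y ⁻¹' Q τ) fun τ _ => measurable_prodMk_left (hQ τ)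
    refine Eq.trans (congrArg P ?_) this
    ext ω
    simp [hA, hY]
  have hev : {ω | typeDist X S k t ω ∈ distanceSet B ∧ ∀ τ ∈ T,
      (typeDist X S k t ω, typeDist X S τ.1 τ.2 ω) ∈ Q τ}
        = (fun ω => (typeDist X S k t ω, Y ω)) ⁻¹' (Prod.fst ⁻¹' distanceSet B ∩ A) := by
    ext ω
    simp [hA, hY]
  have hDA : MeasurableSet (Prod.fst ⁻¹' distanceSet B ∩ A) := (measurable_fst hDm).inter hAm
  rw [hev, ← Measure.map_apply ((hRm (k, t)).prodMk hYm) hDA, hmap, Measure.prod_apply hDA,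
    ← h.setLIntegral_map_typeDist k t hB
      (f := fun y => ∏ τ ∈ T, P {ω | (y, typeDist X S τ.1 τ.2 ω) ∈ Q τ})
      (by simp_rw [← hsec]; exact measurable_measure_prodMk_left hAm),
    ← lintegral_indicator hDm]
  refine lintegral_congr fun y => ?_
  by_cases hy : y ∈ distanceSet B
  · rw [Set.indicator_of_mem hy, ← hsec]
    congr 1
    ext z
    simp [hy]
  · rw [Set.indicator_of_notMem hy]
    have : Prod.mk y ⁻¹' (Prod.fst ⁻¹' distanceSet B ∩ A) = ∅ := by
      ext z
      simp [hy]
    rw [this, measure_empty]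

end IsHetNet

end

/-! ### Received powers and the selection rules in terms of the four distances -/

section

lemma prod_erase_type {M : Type*} [CommMonoid M] (k : Tier) (t : Link) (f : Tier × Link → M) :
    ∏ τ ∈ Finset.univ.erase (k, t), f τ
      = f (k, t.other) * f (k.other, .los) * f (k.other, .nlos) := by
  have hset : (Finset.univ.erase (k, t) : Finset (Tier × Link))
      = {(k, t.other), (k.other, .los), (k.other, .nlos)} := by
    ext ⟨k', t'⟩
    cases k <;> cases t <;> cases k' <;> cases t' <;> simp [Tier.other, Link.other]
  have hk := k.other_ne.symm
  rw [hset, Finset.prod_insert (by simp [hk]), Finset.prod_insert (by simp),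
    Finset.prod_singleton, mul_assoc]

namespace Params

variable (par : Params)

/-- The biased received power as a function of an extended distance: it is `∞` at distance `0`
and `0` at distance `∞`. -/
def extPower (k : Tier) (t : Link) (y : ℝ≥0∞) : ℝ≥0∞ :=
  ENNReal.ofReal (par.power k * par.bias k * par.A t) * y ^ (-(par.α t))

lemma gain_pos (k : Tier) (t : Link) : 0 < par.power k * par.bias k * par.A t :=
  mul_pos (mul_pos (par.power_pos k) (par.bias_pos k)) (par.A_pos t)

lemma continuous_extPower (k : Tier) (t : Link) : Continuous (par.extPower k t) :=
  (ENNReal.continuous_const_mul ENNReal.ofReal_ne_top).comp (ENNReal.continuous_rpow_const)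

lemma strictAnti_extPower (k : Tier) (t : Link) : StrictAnti (par.extPower k t) := by
  intro a b hab
  refine (ENNReal.mul_lt_mul_iff_right (ENNReal.ofReal_pos.2 (par.gain_pos k t)).ne'
    ENNReal.ofReal_ne_top).2 ?_
  rw [ENNReal.rpow_neg, ENNReal.rpow_neg]
  exact ENNReal.inv_lt_inv.2 (ENNReal.rpow_lt_rpow hab (par.α_pos t))

lemma extPower_top (k : Tier) (t : Link) : par.extPower k t ∞ = 0 := by
  rw [extPower, ENNReal.top_rpow_of_neg (neg_neg_of_pos (par.α_pos t)), mul_zero]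

lemma extPower_ofReal (k : Tier) (t : Link) {r : ℝ} (hr : 0 < r) :
    par.extPower k t (ENNReal.ofReal r) = ENNReal.ofReal (par.biasedPower k t r) := by
  rw [extPower, ENNReal.ofReal_rpow_of_pos hr, ← ENNReal.ofReal_mul (par.gain_pos k t).le,
    biasedPower, mul_assoc _ (par.A t)]

lemma biasedPower_nonneg (k : Tier) (t : Link) {r : ℝ} (hr : 0 ≤ r) :
    0 ≤ par.biasedPower k t r := by
  rw [biasedPower, ← mul_assoc]
  exact mul_nonneg (par.gain_pos k t).le (Real.rpow_nonneg hr _)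

lemma measurable_biasedPower (k : Tier) (t : Link) : Measurable (par.biasedPower k t) := by
  unfold biasedPower
  fun_prop

lemma biasedPower_le_iff (k k' : Tier) (t t' : Link) {r : ℝ} (hr : 0 < r) {x : Plane}
    (hx : x ≠ 0) :
    par.biasedPower k' t' ‖x‖ ≤ par.biasedPower k t r
      ↔ par.extPower k' t' ‖x‖ₑ ≤ par.extPower k t (ENNReal.ofReal r) := by
  rw [← ofReal_norm, par.extPower_ofReal k' t' (norm_pos_iff.2 hx), par.extPower_ofReal k t hr,
    ENNReal.ofReal_le_ofReal_iff (par.biasedPower_nonneg k t hr.le)]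

end Params

variable {Ω : Type*} {X : Tier → ℕ → Ω → Plane} {S : Tier → ℕ → Ω → Link} {par : Params}

/-- A continuous decreasing function carries the infimum of the distances to the supremum of the
powers; its value `0` at `∞` covers the empty infimum. -/
lemma extPower_typeDist_le_iff {k : Tier} {t : Link} {ω : Ω} {c : ℝ≥0∞} :
    par.extPower k t (typeDist X S k t ω) ≤ c
      ↔ ∀ i, S k i ω = t → par.extPower k t ‖X k i ω‖ₑ ≤ c := by
  have hc := par.continuous_extPower k t
  have ha := (par.strictAnti_extPower k t).antitone
  have ht := par.extPower_top k t
  rw [typeDist, ha.map_iInf_of_continuousAt hc.continuousAt ht, iSup_le_iff]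
  refine forall_congr' fun i => ?_
  rw [Function.comp_apply, ha.map_iInf_of_continuousAt hc.continuousAt ht, iSup_le_iff]
  rfl

lemma eq_typeDist_iff {k : Tier} {i : ℕ} {t : Link} {ω : Ω} (hi : S k i ω = t) :
    ‖X k i ω‖ₑ = typeDist X S k t ω ↔ ‖X k i ω‖ₑ ≤ typeDist X S k t ω := by
  subst hi
  exact ⟨le_of_eq, fun hle => hle.antisymm (typeDist_le k i ω)⟩

lemma enorm_le_typeDist_iff {k k' : Tier} {i : ℕ} {t : Link} {ω : Ω} :
    ‖X k i ω‖ₑ ≤ typeDist X S k' t ω ↔ ∀ j, S k' j ω = t → ‖X k i ω‖ ≤ ‖X k' j ω‖ := by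
  simp only [typeDist, le_iInf_iff, enorm_le_iff_norm_le]

lemma nearestOfType_iff {k : Tier} {i : ℕ} {t : Link} {ω : Ω} (hi : S k i ω = t) :
    NearestOfType X S ω k i ↔ ‖X k i ω‖ₑ = typeDist X S k t ω := by
  rw [eq_typeDist_iff hi, enorm_le_typeDist_iff, NearestOfType, hi]

lemma nearest_iff {k : Tier} {i : ℕ} {t : Link} {ω : Ω} (hi : S k i ω = t) :
    Nearest X ω k i ↔ ‖X k i ω‖ₑ = typeDist X S k t ω
      ∧ typeDist X S k t ω ≤ typeDist X S k t.other ω := by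
  constructor
  · intro H
    have h1 := (eq_typeDist_iff hi).2 (enorm_le_typeDist_iff.2 fun j _ => H j)
    exact ⟨h1, h1 ▸ enorm_le_typeDist_iff.2 fun j _ => H j⟩
  · rintro ⟨h1, h2⟩ j
    rcases t.eq_or_eq_other (S k j ω) with hj | hj
    · exact enorm_le_typeDist_iff.1 h1.le j hj
    · exact enorm_le_typeDist_iff.1 (h1.le.trans h2) j hj

/-- Comparison within the own type forces the station to be the nearest of that type, by strict
monotonicity of the power. Any other type need only be tested on its nearest distance. -/
lemma associated_iff {k : Tier} {i : ℕ} {t : Link} {ω : Ω} (h0 : ∀ k i, X k i ω ≠ 0)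
    (hi : S k i ω = t) :
    Associated par X S ω k i ↔ ‖X k i ω‖ₑ = typeDist X S k t ω
      ∧ ∀ τ ∈ Finset.univ.erase (k, t), par.extPower τ.1 τ.2 (typeDist X S τ.1 τ.2 ω)
        ≤ par.extPower k t (typeDist X S k t ω) := by
  have key : Associated par X S ω k i ↔ ∀ τ : Tier × Link,
      par.extPower τ.1 τ.2 (typeDist X S τ.1 τ.2 ω) ≤ par.extPower k t ‖X k i ω‖ₑ := by
    simp only [extPower_typeDist_le_iff, Associated, hi,
      par.biasedPower_le_iff _ _ _ _ (norm_pos_iff.2 (h0 k i)) (h0 _ _), ofReal_norm]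
    exact ⟨fun H τ j hj => hj ▸ H τ.1 j, fun H k' j => H (k', S k' j ω) j rfl⟩
  rw [key]
  constructor
  · intro H
    have h1 := (eq_typeDist_iff hi).2 ((par.strictAnti_extPower k t).le_iff_ge.1 (H (k, t)))
    exact ⟨h1, fun τ _ => h1 ▸ H τ⟩
  · rintro ⟨h1, h2⟩ τ
    rw [h1]
    by_cases hτ : τ = (k, t)
    · rw [hτ]
    · exact h2 τ (Finset.mem_erase.2 ⟨hτ, Finset.mem_univ _⟩)

/-- The constraint that a base station of another link state of the same tier is not nearer. -/
def notNearer (k : Tier) (τ : Tier × Link) : Set (ℝ≥0∞ × ℝ≥0∞) := {p | τ.1 = k → p.1 ≤ p.2}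

lemma measurableSet_notNearer (k : Tier) (τ : Tier × Link) : MeasurableSet (notNearer k τ) := by
  by_cases hk : τ.1 = k
  · simpa [notNearer, hk] using measurableSet_le measurable_fst measurable_snd
  · simp [notNearer, hk]

/-- The constraint that a base station of another type does not offer a larger biased received
power. -/
def notStronger (par : Params) (k : Tier) (t : Link) (τ : Tier × Link) : Set (ℝ≥0∞ × ℝ≥0∞) :=
  {p | par.extPower τ.1 τ.2 p.2 ≤ par.extPower k t p.1}

lemma measurableSet_notStronger (k : Tier) (t : Link) (τ : Tier × Link) :
    MeasurableSet (notStronger par k t τ) :=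
  measurableSet_le ((par.continuous_extPower _ _).measurable.comp measurable_snd)
    ((par.continuous_extPower _ _).measurable.comp measurable_fst)

lemma nearest_iff_notNearer {k : Tier} {i : ℕ} {t : Link} {ω : Ω} (hi : S k i ω = t) :
    Nearest X ω k i ↔ ‖X k i ω‖ₑ = typeDist X S k t ω ∧ ∀ τ ∈ Finset.univ.erase (k, t),
      (typeDist X S k t ω, typeDist X S τ.1 τ.2 ω) ∈ notNearer k τ := by
  rw [nearest_iff hi]
  refine and_congr_right fun _ => ⟨?_, fun H => ?_⟩
  · rintro H ⟨k', t'⟩ hτ (rfl : k' = k)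
    rcases t.eq_or_eq_other t' with rfl | rfl
    · simp at hτ
    · exact H
  · exact H (k, t.other) (by simp [t.other_ne]) rfl

variable [MeasurableSpace Ω] {P : Measure Ω} [IsProbabilityMeasure P]

namespace IsHetNet

lemma noStrongerProb_zero (h : IsHetNet par P X S) (k k' : Tier) (t t' : Link) {r : ℝ}
    (hr : 0 < r) :
    noStrongerProb par P X S k t k' t' 0 r
      = P {ω | par.extPower k' t' (typeDist X S k' t' ω)
          ≤ par.extPower k t (ENNReal.ofReal r)} := by
  refine measure_congr (Filter.eventuallyEq_set.2 ?_)
  filter_upwards [h.ae_ne_zero] with ω h0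
  simp only [extPower_typeDist_le_iff, par.biasedPower_le_iff k k' t t' hr (h0 _ _),
    norm_nonneg, true_imp_iff]

/-- The stronger region beyond radius `r` and the open ball of radius `r` are disjoint, so their
void probabilities multiply to that of the union. This expresses `p(r; r)` without any conditioning.
-/
lemma noStrongerProb_mul (h : IsHetNet par P X S) (k k' : Tier) (t t' : Link) {r : ℝ}
    (hr : 0 < r) :
    noStrongerProb par P X S k t k' t' r r * P {ω | ENNReal.ofReal r ≤ typeDist X S k' t' ω}
      = P {ω | ENNReal.ofReal r ≤ typeDist X S k' t' ω
          ∧ par.extPower k' t' (typeDist X S k' t' ω)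
            ≤ par.extPower k t (ENNReal.ofReal r)} := by
  set D : Set Plane := {x | r ≤ ‖x‖ ∧ par.biasedPower k t r < par.biasedPower k' t' ‖x‖} with hD
  have hDm : MeasurableSet D := (measurableSet_le measurable_const measurable_norm).inter
    (measurableSet_lt measurable_const ((par.measurable_biasedPower k' t').comp measurable_norm))
  have hball : originBall (ENNReal.ofReal r) = Metric.ball 0 r :=
    Params.originBall_ofReal r
  have hdisj : Disjoint D (originBall (ENNReal.ofReal r)) := by
    rw [hball, Set.disjoint_left]
    exact fun x hx hx' => (mem_ball_zero_iff.1 hx').not_ge hx.1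
  have h1 : noStrongerProb par P X S k t k' t' r r = expNeg (par.meanCount k' t' D) := by
    rw [← h.measure_avoid_single k' t' hDm, noStrongerProb]
    congr 1
    ext ω
    refine forall_congr' fun j => ?_
    simp only [hD, Set.mem_ofPred_eq, not_and, not_lt]
    exact ⟨fun H hj hr => H hr hj, fun H hr hj => H hj hr⟩
  rw [h1, h.measure_le_typeDist, ← expNeg_add,
    ← par.meanCount_union k' t' (measurableSet_originBall _) hdisj,
    ← h.measure_avoid_single k' t' (hDm.union (measurableSet_originBall _))]
  congr 1
  ext ω
  simp only [Set.mem_ofPred_eq, le_typeDist_iff, extPower_typeDist_le_iff, ← forall_and]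
  refine forall_congr' fun j => ?_
  refine imp_congr_right fun _ => ?_
  rw [Set.mem_union, not_or, and_comm]
  refine and_congr_right fun hb => ?_
  rw [hball, mem_ball_zero_iff, not_lt] at hb
  rw [← par.biasedPower_le_iff k k' t t' hr (norm_pos_iff.1 (hr.trans_le hb))]
  simp [hD, hb]

/-- The distance density for a selection rule that picks a nearest base station of its type when
the distances to the nearest base stations of the other types satisfy given constraints. -/
theorem hasDistanceDensity (h : IsHetNet par P X S) (k : Tier) (t : Link)
    {sel : Ω → ℕ → Prop} {Q : Tier × Link → Set (ℝ≥0∞ × ℝ≥0∞)} (hQ : ∀ τ, MeasurableSet (Q τ))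
    (hsel : ∀ᵐ ω ∂P, ∀ i, S k i ω = t → (sel ω i ↔ ‖X k i ω‖ₑ = typeDist X S k t ω
      ∧ ∀ τ ∈ Finset.univ.erase (k, t),
        (typeDist X S k t ω, typeDist X S τ.1 τ.2 ω) ∈ Q τ))
    {F : ℝ → ℝ≥0∞} (hF : ∀ r, 0 < r →
      P {ω | (ENNReal.ofReal r, typeDist X S k t.other ω) ∈ Q (k, t.other)}
        * P {ω | (ENNReal.ofReal r, typeDist X S k.other .los ω) ∈ Q (k.other, .los)}
        * P {ω | (ENNReal.ofReal r, typeDist X S k.other .nlos ω) ∈ Q (k.other, .nlos)}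
        * ENNReal.ofReal (par.nearestOfTypeDensity k t r) = F r) :
    HasDistanceDensity P X S sel k t F := by
  intro B hB
  rw [← setLIntegral_congr_fun (hB.inter measurableSet_Ioi) fun r hr => hF r hr.2]
  have hmain := h.measure_typeDist_mem k t hB hQ
  simp only [prod_erase_type] at hmain
  rw [← hmain]
  refine measure_congr (Filter.eventuallyEq_set.2 ?_)
  filter_upwards [hsel, h.ae_ne_zero, h.ae_typeDist_attained] with ω hω h0 hatt
  constructor
  · rintro ⟨i, hi, hit, hiB⟩
    obtain ⟨h1, h2⟩ := (hω i hit).1 hi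
    refine ⟨h1 ▸ ⟨⟨enorm_pos.2 (h0 k i), enorm_lt_top⟩, ?_⟩, h2⟩
    rwa [Set.mem_preimage, toReal_enorm]
  -- A finite nearest distance is attained, and an index attaining it is selected.
  · rintro ⟨⟨⟨-, h1⟩, hB'⟩, h2⟩
    obtain ⟨i, hit, hi⟩ := hatt k t h1
    refine ⟨i, (hω i hit).2 ⟨hi, h2⟩, hit, ?_⟩
    rwa [← hi, Set.mem_preimage, toReal_enorm] at hB'

end IsHetNet

end

end HetNet

end

/-! ### The four densities -/

open HetNet in
theorem proposition1 {Ω : Type*} [MeasurableSpace Ω] (P : Measure Ω) [IsProbabilityMeasure P]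
    (par : Params) (X : Tier → ℕ → Ω → Plane) (S : Tier → ℕ → Ω → Link)
    (hnet : IsHetNet par P X S) (k : Tier) (t : Link) :
    -- the nearest base station of the tier, and its link state
    HasDistanceDensity P X S (fun ω i => Nearest X ω k i) k t
      (fun r => ENNReal.ofReal (par.nearestDensity k t r)) ∧
    -- association with the nearest base station of the tier
    HasDistanceDensity P X S (fun ω i => Nearest X ω k i ∧ Associated par X S ω k i) k t
      (fun r => noStrongerProb par P X S k t k t.other r r
        * noStrongerProb par P X S k t k.other .los 0 r
        * noStrongerProb par P X S k t k.other .nlos 0 r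
        * ENNReal.ofReal (par.nearestDensity k t r)) ∧
    -- the nearest base station of the tier with the given link state
    HasDistanceDensity P X S (fun ω i => NearestOfType X S ω k i) k t
      (fun r => ENNReal.ofReal (par.nearestOfTypeDensity k t r)) ∧
    -- association with any base station of the tier
    HasDistanceDensity P X S (fun ω i => Associated par X S ω k i) k t
      (fun r => noStrongerProb par P X S k t k t.other 0 r
        * noStrongerProb par P X S k t k.other .los 0 r
        * noStrongerProb par P X S k t k.other .nlos 0 r
        * ENNReal.ofReal (par.nearestOfTypeDensity k t r)) := by
  have hother := k.other_ne
  have hdens : ∀ r, 0 < r → P {ω | ENNReal.ofReal r ≤ typeDist X S k t.other ω}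
      * ENNReal.ofReal (par.nearestOfTypeDensity k t r)
        = ENNReal.ofReal (par.nearestDensity k t r) := fun r hr => by
    rw [hnet.measure_ofReal_le_typeDist k t.other hr.le,
      ← ENNReal.ofReal_mul (Real.exp_pos _).le, par.exp_neg_meanInBall_other_mul k t hr.le]
  refine ⟨?_, ?_, ?_, ?_⟩
  · refine hnet.hasDistanceDensity k t (measurableSet_notNearer k)
      (Filter.Eventually.of_forall fun ω i => nearest_iff_notNearer) fun r hr => ?_
    -- The other tier is unconstrained, so its two factors are `1`; the other state of the same tier
    -- turns `g` into `f`.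
    simp only [notNearer, Set.mem_ofPred_eq, hother, true_imp_iff, false_imp_iff]
    rw [← hdens r hr]
    simp
  · refine hnet.hasDistanceDensity k t (Q := fun τ => notNearer k τ ∩ notStronger par k t τ)
      (fun τ => (measurableSet_notNearer k τ).inter (measurableSet_notStronger k t τ))
      (hnet.ae_ne_zero.mono fun ω h0 i hi => ?_) fun r hr => ?_
    · rw [nearest_iff_notNearer hi, associated_iff h0 hi, and_and_and_comm, and_self]
      exact and_congr_right fun _ => ⟨fun H τ hτ => ⟨H.1 τ hτ, H.2 τ hτ⟩,
        fun H => ⟨fun τ hτ => (H τ hτ).1, fun τ hτ => (H τ hτ).2⟩⟩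
    · rw [hnet.noStrongerProb_zero _ _ _ _ hr, hnet.noStrongerProb_zero _ _ _ _ hr, ← hdens r hr]
      simp only [notNearer, notStronger, Set.mem_inter_iff, Set.mem_ofPred_eq, hother,
        true_imp_iff, false_imp_iff, true_and]
      -- The joint constraint on the other state splits into `p(r; r)` and the factor that `hdens`
      -- has split off from `f`.
      rw [← hnet.noStrongerProb_mul _ _ _ _ hr]
      ring
  · refine hnet.hasDistanceDensity k t (Q := fun _ => Set.univ) (fun _ => MeasurableSet.univ)
      (Filter.Eventually.of_forall fun ω i hi => ?_) fun r _ => ?_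
    · simp [nearestOfType_iff hi]
    · simp
  · refine hnet.hasDistanceDensity k t (measurableSet_notStronger k t)
      (hnet.ae_ne_zero.mono fun ω h0 i => associated_iff h0) fun r hr => ?_
    rw [hnet.noStrongerProb_zero _ _ _ _ hr, hnet.noStrongerProb_zero _ _ _ _ hr,
      hnet.noStrongerProb_zero _ _ _ _ hr]
    rfl
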